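/- **Hartman–Wintner inequality for a fractional elliptic problem.** Let $N>2$, let $\Omega\subset\mathbb R^N$ be a bounded open set, $-\infty<a<b<\infty$, $D=(a,b)\times\Omega$, $\tfrac12<\alpha\le 1$, $s\in(0,1)$, $\kappa>0$ and $q\in C([a,b])$ real valued. Write $$I_{a+}^{\beta}f(x)=\frac1{\Gamma(\beta)}\int_a^x(x-t)^{\beta-1}f(t)\,dt,\qquad I_{b-}^{\beta}f(x)=\frac1{\Gamma(\beta)}\int_x^b(t-x)^{\beta-1}f(t)\,dt\quad(\beta>0),\qquad I^0_{a+}f=I^0_{b-}f=f,$$ $D_{a+}^{\alpha}f=\frac{d}{dx}I_{a+}^{1-\alpha}f$ (left Riemann–Liouville derivative), $\mathcal D_{b-}^{\alpha}f=-I_{b-}^{1-\alpha}f'$ (right Caputo derivative), and $(-\Delta)^s\varphi(y)=\kappa\ \mathrm{p.v.}\!\int_{\mathbb R^N}\frac{\varphi(y)-\varphi(z)}{|y-z|^{N+2s}}\,dz$, where $\kappa$ is the normalisation constant. *First eigenvalue.* Let $X_0(\Omega)$ be the space of $\varphi\in L^2(\mathbb R^N)$ with $\varphi=0$ outside $\Omega$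 and $\iint\frac{|\varphi(y)-\varphi(z)|^2}{|y-z|^{N+2s}}\,dy\,dz<\infty$, and put $\mathcal E(\varphi,\psi)=\frac{\kappa}{2}\iint\frac{(\varphi(y)-\varphi(z))(\psi(y)-\psi(z))}{|y-z|^{N+2s}}\,dy\,dz$, the bilinear form of $(-\Delta)^s$. A real $\mu$ is an eigenvalue of $(-\Delta)^s\varphi=\mu\varphi$ in $\Omega$, $\varphi=0$ in $\mathbb R^N\setminus\Omega$, if there is a nonzero $\varphi\in X_0(\Omega)$ with $\mathcal E(\varphi,\psi)=\mu\int\varphi\psi$ for all $\psi\in X_0(\Omega)$; $\lambda_1(\Omega)$ is the first (lowest) eigenvalue, i.e. the infimum of the set of eigenvalues. *Solutions.* Consider the problem $$\mathcal L^{\alpha,s}u:=D_{a+,x}^{\alpha}\mathcal D_{b-,x}^{\alpha}u+(-\Delta)^s_yu=q(x)\,u\ \text{ in }D,\qquad u(a,y)=u(b,y)=0\ (y\in\Omega),\qquad u(x,y)=0\ (y\in\mathbb R^N\setminus\Omega).$$ Let $V$ be the space of $\psi\in L^2((a,b)\times\mathbb R^N)$ which vanish for $y\notin\Omega$, are absolutely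 continuous in $x$ on $[a,b]$ with $\psi(a,y)=\psi(b,y)=0$ for almost every $y$, and satisfy $\mathcal D_{b-,x}^{\alpha}\psi\in L^2((a,b)\times\mathbb R^N)$ and $\int_a^b\mathcal E(\psi(x,\cdot),\psi(x,\cdot))\,dx<\infty$. A continuous solution is a function $u\in V$, continuous on $[a,b]\times\mathbb R^N$, which satisfies the boundary conditions pointwise and the equation in the weak sense: $$\int_a^b\!\int_\Omega \mathcal D_{b-,x}^{\alpha}u\;\mathcal D_{b-,x}^{\alpha}\psi\,dy\,dx+\int_a^b\mathcal E(u(x,\cdot),\psi(x,\cdot))\,dx=\int_a^b\!\int_\Omega q(x)\,u\,\psi\,dy\,dx\qquad\text{for all }\psi\in V.$$ *Theorem.* If the problem has a nontrivial continuous solution, then $$\int_a^b\bigl(K(a,a)K(t,t)-K(a,t)^2\bigr)\,[q(t)-\lambda_1(\Omega)]^+\,dt\ \ge\ \frac{(b-a)^{2\alpha-1}}{\Gamma(\alpha)^2(2\alpha-1)},$$ where $[r]^+=\max\{r,0\}$ and $K(x,t)=\frac1{\Gamma(\alpha)^2}\int_{\max\{x,t\}}^b(r-x)^{\alpha-1}(r-t)^{\alpha-1}\,dr$.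 -/

import Mathlib

open Set MeasureTheory
open scoped Topology

noncomputable section

/-- Left Riemann–Liouville fractional integral `I_{a+}^β f`, with `I_{a+}^0 f = f`. -/
def leftRLIntegral (β a : ℝ) (f : ℝ → ℝ) (x : ℝ) : ℝ :=
  if β = 0 then f x else (1 / Real.Gamma β) * ∫ t in a..x, (x - t) ^ (β - 1) * f t

/-- Right Riemann–Liouville fractional integral `I_{b-}^β f`, with `I_{b-}^0 f = f`. -/
def rightRLIntegral (β b : ℝ) (f : ℝ → ℝ) (x : ℝ) : ℝ :=
  if β = 0 then f x else (1 / Real.Gamma β) * ∫ t in x..b, (t - x) ^ (β - 1) * f t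

/-- Left Riemann–Liouville derivative `D_{a+}^α f = (d/dx) I_{a+}^{1-α} f`, `0 < α ≤ 1`. -/
def leftRLDeriv (α a : ℝ) (f : ℝ → ℝ) (x : ℝ) : ℝ :=
  deriv (leftRLIntegral (1 - α) a f) x

/-- Right Caputo derivative `𝒟_{b-}^α f = - I_{b-}^{1-α} f'`, `0 < α ≤ 1`. The minus sign is the
standard one for a right-sided derivative: it gives `I_{b-}^α 𝒟_{b-}^α f = f - f(b)`, and it makes
`D_{a+}^α 𝒟_{b-}^α` the positive operator `-d²/dx²` for `α = 1`. -/
def rightCaputoDeriv (α b : ℝ) (f : ℝ → ℝ) (x : ℝ) : ℝ :=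
  -rightRLIntegral (1 - α) b (deriv f) x

theorem rlIntegral_fubini {β a b : ℝ} (hβ : 0 < β) (hab : a ≤ b) {w g : ℝ → ℝ}
    (hg : Measurable g) {C : ℝ} (hC : ∀ x, |g x| ≤ C) (hw : IntegrableOn w (Ioc a b)) :
    ∫ x in a..b, (∫ t in a..x, (x - t) ^ (β - 1) * w t) * g x =
      ∫ t in a..b, w t * ∫ x in t..b, (x - t) ^ (β - 1) * g x := by
  set W : ℝ → ℝ := (Ioc a b).indicator w with hWdef
  set k : ℝ → ℝ := (Ioc 0 (b - a)).indicator (fun r => r ^ (β - 1)) with hkdef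
  set g' : ℝ → ℝ := (Ioc a b).indicator g with hgdef
  have hW : Integrable W := hw.integrable_indicator measurableSet_Ioc
  have hk : Integrable k := by
    have h := intervalIntegral.intervalIntegrable_rpow' (a := 0) (b := b - a)
      (show -1 < β - 1 by linarith)
    rw [intervalIntegrable_iff_integrableOn_Ioc_of_le (by linarith)] at h
    exact h.integrable_indicator measurableSet_Ioc
  have hgm : Measurable g' := hg.indicator measurableSet_Ioc
  have hgC : ∀ x, ‖g' x‖ ≤ C := by
    intro x
    have h0 : 0 ≤ C := (abs_nonneg _).trans (hC x)
    by_cases hx : x ∈ Ioc a b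
    · simpa [hgdef, hx] using hC x
    · simpa [hgdef, hx] using h0
  have hF : Integrable (fun p : ℝ × ℝ => W p.2 * k (p.1 - p.2) * g' p.1)
      (volume.prod volume) := by
    have h1 := hW.convolution_integrand (ContinuousLinearMap.mul ℝ ℝ) hk
    refine h1.mul_bdd (g := fun p : ℝ × ℝ => g' p.1) (c := C) ?_ ?_
    · exact (hgm.comp measurable_fst).aestronglyMeasurable
    · exact Filter.Eventually.of_forall fun p => hgC p.1
  have hswap := integral_integral_swap (f := fun x t => W t * k (x - t) * g' x) hF
  have hL : ∫ x in a..b, (∫ t in a..x, (x - t) ^ (β - 1) * w t) * g x =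
      ∫ x, ∫ t, W t * k (x - t) * g' x := by
    rw [intervalIntegral.integral_of_le hab, ← integral_indicator measurableSet_Ioc]
    refine integral_congr_ae (Filter.Eventually.of_forall fun x => ?_)
    by_cases hx : x ∈ Ioc a b
    · simp only [indicator_of_mem hx, hgdef]
      rw [integral_mul_const, intervalIntegral.integral_of_le hx.1.le, integral_Ioc_eq_integral_Ioo,
        ← integral_indicator measurableSet_Ioo]
      congr 2
      ext t
      by_cases ht : t ∈ Ioo a x
      · have h1 : t ∈ Ioc a b := ⟨ht.1, ht.2.le.trans hx.2⟩
        have h2 : x - t ∈ Ioc 0 (b - a) := ⟨by linarith [ht.2], by linarith [ht.1, hx.2]⟩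
        simp only [indicator_of_mem ht, hWdef, hkdef, indicator_of_mem h1, indicator_of_mem h2]
        ring
      · rw [indicator_of_notMem ht]
        by_cases h1 : t ∈ Ioc a b
        · have h2 : x - t ∉ Ioc 0 (b - a) := fun h => ht ⟨h1.1, by linarith [h.1]⟩
          simp [hkdef, indicator_of_notMem h2]
        · simp [hWdef, indicator_of_notMem h1]
    · simp [hgdef, indicator_of_notMem hx]
  have hR : ∫ t in a..b, w t * ∫ x in t..b, (x - t) ^ (β - 1) * g x =
      ∫ t, ∫ x, W t * k (x - t) * g' x := by
    rw [intervalIntegral.integral_of_le hab, ← integral_indicator measurableSet_Ioc]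
    refine integral_congr_ae (Filter.Eventually.of_forall fun t => ?_)
    by_cases ht : t ∈ Ioc a b
    · simp only [indicator_of_mem ht, hWdef, mul_assoc]
      rw [integral_const_mul, intervalIntegral.integral_of_le ht.2,
        ← integral_indicator measurableSet_Ioc]
      congr 2
      ext x
      by_cases hx : x ∈ Ioc t b
      · have h1 : x ∈ Ioc a b := ⟨ht.1.trans hx.1, hx.2⟩
        have h2 : x - t ∈ Ioc 0 (b - a) := ⟨by linarith [hx.1], by linarith [ht.1, hx.2]⟩
        simp only [indicator_of_mem hx, hgdef, hkdef, indicator_of_mem h1, indicator_of_mem h2]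
      · rw [indicator_of_notMem hx]
        by_cases h1 : x ∈ Ioc a b
        · have h2 : x - t ∉ Ioc 0 (b - a) := fun h => hx ⟨by linarith [h.1], h1.2⟩
          simp [hkdef, indicator_of_notMem h2]
        · simp [hgdef, indicator_of_notMem h1]
    · simp [hWdef, indicator_of_notMem ht]
  rw [hL, hR, hswap]

/-- Integration by parts: `∫ (D_{a+}^α w) ψ = ∫ w 𝒟_{b-}^α ψ` for smooth `ψ` compactly supported in
`(a,b)`. It is what turns `D_{a+}^α 𝒟_{b-}^α u` into the bilinear form `∫ 𝒟_{b-}^α u 𝒟_{b-}^α ψ`. -/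
theorem integral_leftRLDeriv_mul {α a b : ℝ} (hα : α ≤ 1) (hab : a ≤ b) {w ψ : ℝ → ℝ}
    (hw : IntegrableOn w (Ioc a b))
    (hJ : ∀ c d, a < c → c ≤ d → d < b →
      AbsolutelyContinuousOnInterval (leftRLIntegral (1 - α) a w) c d)
    (hψ : ContDiff ℝ 1 ψ) (hψc : HasCompactSupport ψ) (hψs : tsupport ψ ⊆ Ioo a b) :
    ∫ x in a..b, leftRLDeriv α a w x * ψ x = ∫ x in a..b, w x * rightCaputoDeriv α b ψ x := by
  have hψ' : Continuous (deriv ψ) := hψ.continuous_deriv le_rfl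
  set J := leftRLIntegral (1 - α) a w with hJdef
  have key : ∫ x in a..b, deriv J x * ψ x = - ∫ x in a..b, J x * deriv ψ x := by
    rcases (tsupport ψ).eq_empty_or_nonempty with he | hne
    · have h0 : ψ = 0 := by simpa [tsupport_eq_empty_iff] using he
      simp [h0]
    · obtain ⟨c, hcmem, hc⟩ := hψc.isCompact.exists_isLeast hne
      obtain ⟨d, hdmem, hd⟩ := hψc.isCompact.exists_isGreatest hne
      have hac := (hψs hcmem).1
      have hdb := (hψs hdmem).2
      obtain ⟨c', hc'1, hc'2⟩ := exists_between hac
      obtain ⟨d', hd'1, hd'2⟩ := exists_between hdb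
      have hcd : c ≤ d := hc hdmem
      have hc'd' : c' ≤ d' := by linarith
      have hout : ∀ x, x ∉ Ioc c' d' → ψ x = 0 ∧ deriv ψ x = 0 := by
        intro x hx
        have hx' : x ∉ tsupport ψ := fun h => hx ⟨by linarith [hc h], by linarith [hd h]⟩
        refine ⟨image_eq_zero_of_notMem_tsupport hx', ?_⟩
        exact Function.notMem_support.1 fun h => hx' (support_deriv_subset h)
      have hends : ψ c' = 0 ∧ ψ d' = 0 := by
        constructor
        · exact (hout c' (by simp)).1
        · exact image_eq_zero_of_notMem_tsupport fun h => by linarith [hd h]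
      have hsub : Ioc c' d' ⊆ Ioc a b := Ioc_subset_Ioc hc'1.le hd'2.le
      have e1 : ∫ x in a..b, deriv J x * ψ x = ∫ x in c'..d', deriv J x * ψ x := by
        rw [intervalIntegral.integral_of_le hab, intervalIntegral.integral_of_le hc'd']
        exact (setIntegral_eq_of_subset_of_forall_sdiff_eq_zero measurableSet_Ioc hsub
          fun x hx => by simp [(hout x hx.2).1])
      have e2 : ∫ x in a..b, J x * deriv ψ x = ∫ x in c'..d', J x * deriv ψ x := by
        rw [intervalIntegral.integral_of_le hab, intervalIntegral.integral_of_le hc'd']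
        exact (setIntegral_eq_of_subset_of_forall_sdiff_eq_zero measurableSet_Ioc hsub
          fun x hx => by simp [(hout x hx.2).2])
      have hψac : AbsolutelyContinuousOnInterval ψ c' d' :=
        hψ.contDiffOn.absolutelyContinuousOnInterval
      have := (hJ c' d' hc'1 hc'd' hd'2).integral_mul_deriv_eq_deriv_mul hψac
      rw [hends.1, hends.2] at this
      rw [e1, e2, this]; ring
  have hgoal : ∫ x in a..b, leftRLDeriv α a w x * ψ x = ∫ x in a..b, deriv J x * ψ x := rfl
  rw [hgoal, key]
  rcases hα.eq_or_lt with rfl | hα'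
  · rw [← intervalIntegral.integral_neg]
    refine intervalIntegral.integral_congr fun x _ => ?_
    simp [hJdef, leftRLIntegral, rightCaputoDeriv, rightRLIntegral]
  · have hβ : 0 < 1 - α := by linarith
    obtain ⟨C, hC⟩ := hψ'.bounded_above_of_compact_support hψc.deriv
    have hF := rlIntegral_fubini hβ hab hψ'.measurable (C := C) hC hw
    simp only [hJdef, leftRLIntegral, rightCaputoDeriv, rightRLIntegral, hβ.ne', if_false]
    simp only [mul_assoc, intervalIntegral.integral_const_mul, mul_neg,
      intervalIntegral.integral_neg, mul_left_comm (w _)]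
    rw [hF]

/-- The kernel `K(x,t) = Γ(α)⁻² ∫_{max{x,t}}^b (r-x)^{α-1} (r-t)^{α-1} dr`. -/
def rlKernel (α b x t : ℝ) : ℝ :=
  (1 / Real.Gamma α ^ 2) * ∫ r in (max x t)..b, (r - x) ^ (α - 1) * (r - t) ^ (α - 1)

/-- The energy space of the Dirichlet fractional Laplacian on `Ω`: square integrable functions on
`ℝ^N` which vanish outside `Ω` and have a finite Gagliardo seminorm of order `s`. -/
structure MemFracEnergy {N : ℕ} (s : ℝ) (Ω : Set (EuclideanSpace ℝ (Fin N)))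
    (φ : EuclideanSpace ℝ (Fin N) → ℝ) : Prop where
  memLp : MemLp φ 2 volume
  eq_zero : ∀ y ∉ Ω, φ y = 0
  energy : Integrable
    (fun p : EuclideanSpace ℝ (Fin N) × EuclideanSpace ℝ (Fin N) =>
      (φ p.1 - φ p.2) ^ 2 / ‖p.1 - p.2‖ ^ ((N : ℝ) + 2 * s)) (volume.prod volume)

/-- The bilinear form `⟨(-Δ)^s φ, ψ⟩` of the fractional Laplacian
`(-Δ)^s φ(y) = κ p.v. ∫ (φ(y) - φ(z)) / |y-z|^{N+2s} dz` with normalisation constant `κ`. -/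
def fracForm {N : ℕ} (κ s : ℝ) (φ ψ : EuclideanSpace ℝ (Fin N) → ℝ) : ℝ :=
  (κ / 2) * ∫ p : EuclideanSpace ℝ (Fin N) × EuclideanSpace ℝ (Fin N),
    (φ p.1 - φ p.2) * (ψ p.1 - ψ p.2) / ‖p.1 - p.2‖ ^ ((N : ℝ) + 2 * s)

/-- `μ` is an eigenvalue of `(-Δ)^s φ = μ φ` in `Ω`, `φ = 0` outside `Ω`. -/
def IsFracDirichletEigenvalue {N : ℕ} (κ s : ℝ) (Ω : Set (EuclideanSpace ℝ (Fin N)))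
    (μ : ℝ) : Prop :=
  ∃ φ : EuclideanSpace ℝ (Fin N) → ℝ, MemFracEnergy s Ω φ ∧ ¬ (φ =ᵐ[volume] 0) ∧
    ∀ ψ : EuclideanSpace ℝ (Fin N) → ℝ, MemFracEnergy s Ω ψ →
      fracForm κ s φ ψ = μ * ∫ y, φ y * ψ y

/-- The first eigenvalue `λ₁(Ω)` of the Dirichlet fractional Laplacian. -/
def firstEigenvalue {N : ℕ} (κ s : ℝ) (Ω : Set (EuclideanSpace ℝ (Fin N))) : ℝ :=
  sInf {μ : ℝ | IsFracDirichletEigenvalue κ s Ω μ}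

/-- The energy space of `D_{a+,x}^α 𝒟_{b-,x}^α + (-Δ)^s_y` on `(a,b) × Ω` with the Dirichlet
conditions `ψ(a,y) = ψ(b,y) = 0` and `ψ(x,y) = 0` for `y ∉ Ω`. -/
structure MemCylEnergy {N : ℕ} (α s a b : ℝ) (Ω : Set (EuclideanSpace ℝ (Fin N)))
    (ψ : ℝ → EuclideanSpace ℝ (Fin N) → ℝ) : Prop where
  memLp : MemLp (fun p : ℝ × EuclideanSpace ℝ (Fin N) => ψ p.1 p.2) 2
    ((volume.restrict (Ioo a b)).prod volume)
  eq_zero : ∀ x ∈ Icc a b, ∀ y ∉ Ω, ψ x y = 0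
  absCont : ∀ᵐ y : EuclideanSpace ℝ (Fin N),
    AbsolutelyContinuousOnInterval (fun x => ψ x y) a b ∧ ψ a y = 0 ∧ ψ b y = 0
  memLp_caputo : MemLp
    (fun p : ℝ × EuclideanSpace ℝ (Fin N) => rightCaputoDeriv α b (fun x => ψ x p.2) p.1) 2
    ((volume.restrict (Ioo a b)).prod volume)
  energy : Integrable
    (fun p : ℝ × EuclideanSpace ℝ (Fin N) × EuclideanSpace ℝ (Fin N) =>
      (ψ p.1 p.2.1 - ψ p.1 p.2.2) ^ 2 / ‖p.2.1 - p.2.2‖ ^ ((N : ℝ) + 2 * s))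
    ((volume.restrict (Ioo a b)).prod (volume.prod volume))

/-- `u` is a continuous solution of `D_{a+,x}^α 𝒟_{b-,x}^α u + (-Δ)^s_y u = q(x) u` in
`(a,b) × Ω` with `u(a,y) = u(b,y) = 0` for `y ∈ Ω` and `u(x,y) = 0` for `y ∉ Ω`: it is continuous,
satisfies the boundary conditions pointwise, and satisfies the equation in the weak sense. -/
structure IsContinuousSolution {N : ℕ} (α s κ a b : ℝ) (Ω : Set (EuclideanSpace ℝ (Fin N)))
    (q : ℝ → ℝ) (u : ℝ → EuclideanSpace ℝ (Fin N) → ℝ) : Prop where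
  continuousOn : ContinuousOn (fun p : ℝ × EuclideanSpace ℝ (Fin N) => u p.1 p.2)
    (Icc a b ×ˢ univ)
  left : ∀ y ∈ Ω, u a y = 0
  right : ∀ y ∈ Ω, u b y = 0
  exterior : ∀ x ∈ Icc a b, ∀ y ∉ Ω, u x y = 0
  memEnergy : MemCylEnergy α s a b Ω u
  weak : ∀ ψ : ℝ → EuclideanSpace ℝ (Fin N) → ℝ, MemCylEnergy α s a b Ω ψ →
    (∫ x in Ioo a b, ∫ y in Ω,
        rightCaputoDeriv α b (fun t => u t y) x * rightCaputoDeriv α b (fun t => ψ t y) x) +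
      (∫ x in Ioo a b, fracForm κ s (u x) (ψ x)) =
      ∫ x in Ioo a b, ∫ y in Ω, q x * u x y * ψ x y

end

/-!
A solution is bounded pointwise by its fractional derivative, its fractional derivative is bounded
in `L²` by the zeroth order term through the energy identity, and the inequality says that these two
bounds must be compatible. No separation of variables is needed.

*One variable.* Let `e_x(t) = (t - x)_+^{α-1} / Γ(α)`, which lies in `L²(a,b)` because `α > 1/2`. If
`f` is absolutely continuous with `f(b) = 0` and `w = 𝒟_{b-}^α f`, then `f(x) = ∫ e_x w`
(`integral_rpow_mul_rightCaputoDeriv`), and `K(x,t) = ∫ e_x e_t`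
(`integral_evalRepr_mul_evalRepr`). If also `f(a) = 0`, then `w` is orthogonal to `e_a`, so that
`K(a,a) f(x) = ∫ (K(a,a) e_x - K(a,x) e_a) w`, and Cauchy–Schwarz gives
`K(a,a) f(x)² ≤ (K(a,a) K(x,x) - K(a,x)²) ∫ w²` (`rlKernel_mul_sq_le`).

*The other variables.* The form of `(-Δ)^s` satisfies `λ₁ ‖φ‖² ≤ ℰ(φ,φ)`
(`firstEigenvalue_mul_integral_sq_le`). For this it is enough that the Rayleigh quotient attains its
minimum, since the minimum is then an eigenvalue. The compactness needed for that comes from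
averaging over the cubes of a fine grid: the variance of `φ` on a cube is controlled by the
Gagliardo seminorm, so that finitely many averages determine `φ` in `L²` up to a small error
(`exists_friedrichs`, `totallyBounded_energyBall`).

*Conclusion.* Put `U(x) = ‖u(x,·)‖²` and `T = ‖𝒟_{b-}^α u‖²`, which is positive as `u` is
nontrivial. Testing the weak equation with `u` gives
`T = ∫ q U - ∫ ℰ(u(x,·),u(x,·)) dx ≤ ∫ [q - λ₁]⁺ U`, while the first part, integrated in `y`, gives
`K(a,a) U(x) ≤ (K(a,a) K(x,x) - K(a,x)²) T`. Combining the two and dividing by `T` bounds `K(a,a)`,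
which is the left-hand side of the inequality.
-/

/-! ### Fractional calculus in one variable -/

/-- The Cauchy–Schwarz inequality for square integrable real functions. -/
theorem sq_integral_mul_le_integral_sq_mul {X : Type*} [MeasurableSpace X] {μ : Measure X}
    {f g : X → ℝ} (hf : MemLp f 2 μ) (hg : MemLp g 2 μ) :
    (∫ x, f x * g x ∂μ) ^ 2 ≤ (∫ x, f x ^ 2 ∂μ) * ∫ x, g x ^ 2 ∂μ := by
  have hff := hf.integrable_sq
  have hgg := hg.integrable_sq
  have hfg : Integrable (fun x => f x * g x) μ := hf.integrable_mul hg
  have h : ∀ t : ℝ, 0 ≤ (∫ x, g x ^ 2 ∂μ) * (t * t) + (2 * ∫ x, f x * g x ∂μ) * t +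
      ∫ x, f x ^ 2 ∂μ := by
    intro t
    have h0 : 0 ≤ ∫ x, (f x + t * g x) ^ 2 ∂μ := integral_nonneg fun x => sq_nonneg _
    have h1 : ∫ x, (f x + t * g x) ^ 2 ∂μ =
        ∫ x, ((g x ^ 2 * (t * t) + f x * g x * (2 * t)) + f x ^ 2) ∂μ := by
      congr 1; ext x; ring
    have h2 : Integrable (fun x => g x ^ 2 * (t * t) + f x * g x * (2 * t)) μ :=
      (hgg.mul_const _).add (hfg.mul_const _)
    rw [h1, integral_add h2 hff,
      integral_add (hgg.mul_const _) (hfg.mul_const _), integral_mul_const,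
      integral_mul_const] at h0
    linarith
  have := discrim_le_zero h
  rw [discrim] at this
  nlinarith

/-- The Beta integral `B(α, 1 - α)`, transported to an arbitrary interval. -/
theorem integral_rpow_mul_rpow_neg {α x r : ℝ} (hα : 0 < α) (hα1 : α < 1) (hxr : x < r) :
    ∫ t in x..r, (t - x) ^ (α - 1) * (r - t) ^ (-α) = Real.Gamma α * Real.Gamma (1 - α) := by
  have h := Complex.betaIntegral_scaled (α : ℂ) ((1 - α : ℝ) : ℂ) (sub_pos.2 hxr)
  have h2 := Complex.Gamma_mul_Gamma_eq_betaIntegral (s := (α : ℂ)) (t := ((1 - α : ℝ) : ℂ))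
    (by simpa using hα) (by simpa using hα1)
  have e1 : (α : ℂ) + ((1 - α : ℝ) : ℂ) = 1 := by push_cast; ring
  rw [e1, Complex.Gamma_one, one_mul] at h2
  rw [e1, sub_self, Complex.cpow_zero, one_mul, ← h2, Complex.Gamma_ofReal, Complex.Gamma_ofReal]
    at h
  have h3 : ∫ t in x..r, (t - x) ^ (α - 1) * (r - t) ^ (-α) =
      ∫ t in (0 : ℝ)..(r - x), t ^ (α - 1) * ((r - x) - t) ^ (-α) := by
    rw [← sub_self x, ← intervalIntegral.integral_comp_sub_right
      (fun t => t ^ (α - 1) * ((r - x) - t) ^ (-α)) x]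
    refine intervalIntegral.integral_congr fun t _ => ?_
    simp
  rw [h3]
  apply Complex.ofReal_injective
  rw [← intervalIntegral.integral_ofReal]
  push_cast
  rw [← h]
  refine intervalIntegral.integral_congr fun t ht => ?_
  rw [uIcc_of_le (by linarith)] at ht
  rw [Complex.ofReal_cpow ht.1, Complex.ofReal_cpow (by linarith [ht.2])]
  push_cast
  congr 2
  ring

/-- The singular kernel `(t - x)^{α-1} (r - t)^{-α}` on `x < t < r`, extended by zero to `r ≤ t`. -/
noncomputable def abelKernel (α x t r : ℝ) : ℝ :=
  if t < r then (t - x) ^ (α - 1) * (r - t) ^ (-α) else 0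

theorem measurable_abelKernel (α x : ℝ) :
    Measurable (fun p : ℝ × ℝ => abelKernel α x p.1 p.2) := by
  unfold abelKernel
  refine Measurable.ite (measurableSet_lt measurable_fst measurable_snd) ?_ measurable_const
  fun_prop

theorem abelKernel_nonneg {α x t : ℝ} (hxt : x ≤ t) (r : ℝ) : 0 ≤ abelKernel α x t r := by
  unfold abelKernel
  split_ifs with h
  · exact mul_nonneg (Real.rpow_nonneg (by linarith) _) (Real.rpow_nonneg (by linarith) _)
  · exact le_rfl

theorem setIntegral_abelKernel {α x b r : ℝ} (hα : 0 < α) (hα1 : α < 1) (hr : r ∈ Ioc x b) :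
    ∫ t in Ioc x b, abelKernel α x t r = Real.Gamma α * Real.Gamma (1 - α) := by
  rw [← integral_rpow_mul_rpow_neg hα hα1 hr.1, intervalIntegral.integral_of_le hr.1.le,
    integral_Ioc_eq_integral_Ioo (x := x) (y := r)]
  rw [setIntegral_eq_of_subset_of_forall_sdiff_eq_zero (s := Ioo x r)
    (f := fun t => abelKernel α x t r) measurableSet_Ioc
    (fun t ht => ⟨ht.1, ht.2.le.trans hr.2⟩)
    (fun t ht => if_neg fun h => ht.2 ⟨ht.1.1, h⟩)]
  exact setIntegral_congr_fun measurableSet_Ioo fun t ht => if_pos ht.2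

/-- `I_{b-}^α 𝒟_{b-}^α f = f` for absolutely continuous `f` with `f(b) = 0`. -/
theorem integral_rpow_mul_rightCaputoDeriv {α a b x : ℝ} (hα : 0 < α) (hα1 : α ≤ 1) {f : ℝ → ℝ}
    (hx : x ∈ Icc a b) (hf : AbsolutelyContinuousOnInterval f a b) (hfb : f b = 0) :
    ∫ t in x..b, (t - x) ^ (α - 1) * rightCaputoDeriv α b f t = Real.Gamma α * f x := by
  have hfx : AbsolutelyContinuousOnInterval f x b :=
    hf.mono (by rw [uIcc_of_le hx.2, uIcc_of_le (hx.1.trans hx.2)]; exact Icc_subset_Icc_left hx.1)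
  have hFTC := hfx.integral_deriv_eq_sub
  have hint := hfx.intervalIntegrable_deriv
  rw [hfb, zero_sub] at hFTC
  rcases hα1.eq_or_lt with rfl | hα1
  · simp [rightCaputoDeriv, rightRLIntegral, hFTC]
  have hβ : 1 - α ≠ 0 := by linarith
  rw [intervalIntegrable_iff_integrableOn_Ioc_of_le hx.2] at hint
  rw [intervalIntegral.integral_of_le hx.2] at hFTC ⊢
  set μ : Measure ℝ := volume.restrict (Ioc x b) with hμ
  have hΓ := Real.Gamma_pos_of_pos hα
  have hΓ' : 0 < Real.Gamma (1 - α) := Real.Gamma_pos_of_pos (by linarith)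
  have hF : Integrable (fun p : ℝ × ℝ => abelKernel α x p.1 p.2 * deriv f p.2) (μ.prod μ) := by
    have hm : Measurable fun p : ℝ × ℝ => abelKernel α x p.1 p.2 * deriv f p.2 :=
      (measurable_abelKernel α x).mul ((measurable_deriv f).comp measurable_snd)
    rw [integrable_prod_iff' hm.aestronglyMeasurable]
    constructor
    · filter_upwards [ae_restrict_mem measurableSet_Ioc] with r hr
      -- The Beta integral is nonzero, which a nonintegrable function would not give.
      refine Integrable.mul_const (not_imp_comm.1 integral_undef ?_) _
      rw [hμ, setIntegral_abelKernel hα hα1 hr]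
      positivity
    · refine (hint.norm.const_mul (Real.Gamma α * Real.Gamma (1 - α))).congr ?_
      filter_upwards [ae_restrict_mem measurableSet_Ioc] with r hr
      simp only [norm_mul]
      rw [integral_mul_const, ← setIntegral_abelKernel hα hα1 hr]
      congr 1
      refine setIntegral_congr_fun measurableSet_Ioc fun t ht => ?_
      simp only [Real.norm_of_nonneg (abelKernel_nonneg ht.1.le r)]
  -- Integrating first in `t` gives a Beta integral, integrating first in `r` the Caputo derivative.
  have hswap := integral_integral_swap (f := fun t r => abelKernel α x t r * deriv f r) hF
  have hR : ∫ r, ∫ t, abelKernel α x t r * deriv f r ∂μ ∂μ =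
      Real.Gamma α * Real.Gamma (1 - α) * -f x := by
    rw [← hFTC, ← integral_const_mul]
    refine integral_congr_ae ?_
    filter_upwards [ae_restrict_mem measurableSet_Ioc] with r hr
    rw [integral_mul_const, hμ, setIntegral_abelKernel hα hα1 hr]
  have hL : ∫ t, ∫ r, abelKernel α x t r * deriv f r ∂μ ∂μ =
      -Real.Gamma (1 - α) * ∫ t in Ioc x b, (t - x) ^ (α - 1) * rightCaputoDeriv α b f t := by
    rw [← integral_const_mul]
    refine integral_congr_ae ?_
    filter_upwards [ae_restrict_mem measurableSet_Ioc] with t ht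
    have h1 : ∫ r, abelKernel α x t r * deriv f r ∂μ =
        (t - x) ^ (α - 1) * ∫ r in t..b, (r - t) ^ (-α) * deriv f r := by
      rw [intervalIntegral.integral_of_le ht.2, ← integral_const_mul, hμ,
        ← integral_indicator measurableSet_Ioc, ← integral_indicator measurableSet_Ioc]
      congr 1; ext r
      by_cases hr : r ∈ Ioc t b
      · have : r ∈ Ioc x b := ⟨ht.1.trans hr.1, hr.2⟩
        simp [this, hr, abelKernel, hr.1, mul_assoc]
      · by_cases hr' : r ∈ Ioc x b
        · have : ¬ t < r := fun h => hr ⟨h, hr'.2⟩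
          simp [this, hr', hr, abelKernel]
        · simp [hr, hr']
    rw [h1]
    simp only [rightCaputoDeriv, rightRLIntegral, if_neg hβ]
    rw [show 1 - α - 1 = -α by ring]
    field_simp
  rw [hL, hR] at hswap
  have : Real.Gamma (1 - α) * (∫ t in Ioc x b, (t - x) ^ (α - 1) * rightCaputoDeriv α b f t) =
      Real.Gamma (1 - α) * (Real.Gamma α * f x) := by linarith
  exact mul_left_cancel₀ hΓ'.ne' this

/-- The representer `e_x(t) = (t - x)_+^{α-1} / Γ(α)` of the evaluation at `x`: for absolutely
continuous `v` with `v(b) = 0` one has `v(x) = ∫ e_x 𝒟_{b-}^α v`. -/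
noncomputable def evalRepr (α x t : ℝ) : ℝ :=
  (Ioi x).indicator (fun t => (t - x) ^ (α - 1) / Real.Gamma α) t

theorem measurable_evalRepr (α : ℝ) : Measurable (fun p : ℝ × ℝ => evalRepr α p.1 p.2) := by
  have : (fun p : ℝ × ℝ => evalRepr α p.1 p.2) =
      fun p : ℝ × ℝ => if p.1 < p.2 then (p.2 - p.1) ^ (α - 1) / Real.Gamma α else 0 := by
    ext p; simp [evalRepr, indicator_apply]
  rw [this]
  refine Measurable.ite (measurableSet_lt measurable_fst measurable_snd) ?_ measurable_const
  fun_prop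

theorem integral_evalRepr_mul {a b x : ℝ} (α : ℝ) (hx : x ∈ Icc a b) (g : ℝ → ℝ) :
    ∫ t in Ioo a b, evalRepr α x t * g t =
      ∫ t in x..b, (t - x) ^ (α - 1) / Real.Gamma α * g t := by
  rw [intervalIntegral.integral_of_le hx.2, integral_Ioc_eq_integral_Ioo,
    ← integral_indicator measurableSet_Ioo, ← integral_indicator measurableSet_Ioo]
  congr 1; ext t
  by_cases ht : t ∈ Ioo x b
  · have : t ∈ Ioo a b := ⟨hx.1.trans_lt ht.1, ht.2⟩
    simp [ht, this, evalRepr, ht.1]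
  · by_cases ht' : t ∈ Ioo a b
    · have : ¬ x < t := fun h => ht ⟨h, ht'.2⟩
      simp [ht, ht', evalRepr, this]
    · simp [ht, ht']

/-- The kernel `K` is the Gram kernel of the representers `e_x` in `L²(a,b)`. -/
theorem integral_evalRepr_mul_evalRepr {a b x y : ℝ} (α : ℝ) (hx : x ∈ Icc a b)
    (hy : y ∈ Icc a b) :
    ∫ t in Ioo a b, evalRepr α x t * evalRepr α y t = rlKernel α b x y := by
  wlog hxy : y ≤ x generalizing x y
  · rw [rlKernel, max_comm]
    simp_rw [mul_comm (evalRepr α x _)]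
    rw [this hy hx (not_le.1 hxy).le, rlKernel]
    simp_rw [mul_comm]
  rw [integral_evalRepr_mul α hx, rlKernel, max_eq_left hxy,
    ← intervalIntegral.integral_const_mul, intervalIntegral.integral_of_le hx.2,
    intervalIntegral.integral_of_le hx.2]
  refine setIntegral_congr_fun measurableSet_Ioc fun t ht => ?_
  have : y < t := hxy.trans_lt ht.1
  simp only [evalRepr, mem_Ioi, this, indicator_of_mem]
  ring

theorem rlKernel_self {α b x : ℝ} (hα : 1 / 2 < α) (hx : x ≤ b) :
    rlKernel α b x x = (b - x) ^ (2 * α - 1) / (Real.Gamma α ^ 2 * (2 * α - 1)) := by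
  have h : ∫ r in x..b, (r - x) ^ (α - 1) * (r - x) ^ (α - 1) =
      ∫ r in x..b, (r - x) ^ (2 * α - 2) := by
    rw [intervalIntegral.integral_of_le hx, intervalIntegral.integral_of_le hx]
    refine setIntegral_congr_fun measurableSet_Ioc fun t ht => ?_
    have := Real.rpow_add (sub_pos.2 ht.1) (α - 1) (α - 1)
    rw [show α - 1 + (α - 1) = 2 * α - 2 by ring] at this
    exact this.symm
  rw [rlKernel, max_self, h, intervalIntegral.integral_comp_sub_right (fun r => r ^ (2 * α - 2)),
    sub_self, integral_rpow (Or.inl (by linarith)), show 2 * α - 2 + 1 = 2 * α - 1 by ring,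
    Real.zero_rpow (by linarith), sub_zero, div_mul_div_comm, one_mul]

theorem memLp_evalRepr {α a b x : ℝ} (hα : 1 / 2 < α) (hx : x ∈ Icc a b) :
    MemLp (evalRepr α x) 2 (volume.restrict (Ioo a b)) := by
  have hm : Measurable (evalRepr α x) := (measurable_evalRepr α).comp measurable_prodMk_left
  rw [memLp_two_iff_integrable_sq hm.aestronglyMeasurable]
  have hi : IntervalIntegrable (fun r : ℝ => r ^ (2 * α - 2)) volume (x - x) (b - x) :=
    intervalIntegral.intervalIntegrable_rpow' (by linarith)
  have h1 := (hi.comp_sub_right x)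
  simp only [sub_add_cancel] at h1
  rw [intervalIntegrable_iff_integrableOn_Ioo_of_le hx.2] at h1
  have h2 := (h1.integrable_indicator measurableSet_Ioo).div_const (Real.Gamma α ^ 2)
  refine (h2.integrableOn (s := Ioo a b)).congr ?_
  filter_upwards [ae_restrict_mem measurableSet_Ioo] with t ht
  by_cases h : x < t
  · have h3 : t ∈ Ioo x b := ⟨h, ht.2⟩
    simp only [h3, indicator_of_mem, evalRepr, mem_Ioi, h]
    rw [div_pow, ← Real.rpow_natCast ((t - x) ^ (α - 1)), ← Real.rpow_mul (by linarith)]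
    congr 2
    push_cast; ring
  · have h3 : t ∉ Ioo x b := fun h' => h h'.1
    simp [h3, evalRepr, h]

theorem rlKernel_self_pos {α a b : ℝ} (hα : 1 / 2 < α) (hab : a < b) : 0 < rlKernel α b a a := by
  rw [rlKernel_self hα hab.le]
  have := Real.Gamma_pos_of_pos (show 0 < α by linarith)
  have h1 := Real.rpow_pos_of_pos (sub_pos.2 hab) (2 * α - 1)
  have : 0 < 2 * α - 1 := by linarith
  positivity

/-- The pointwise bound behind the inequality. If `f` vanishes at both ends, then `𝒟_{b-}^α f` is
orthogonal to `e_a`, so the value of `f` at `x` is the pairing with the component of `e_x`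
orthogonal to `e_a`, and the Gram determinant of `e_a`, `e_x` appears by Cauchy–Schwarz. -/
theorem rlKernel_mul_sq_le {α a b x : ℝ} (hα : 1 / 2 < α) (hα1 : α ≤ 1) (hab : a < b)
    (hx : x ∈ Icc a b) {f : ℝ → ℝ} (hf : AbsolutelyContinuousOnInterval f a b) (hfa : f a = 0)
    (hfb : f b = 0) (hw : MemLp (rightCaputoDeriv α b f) 2 (volume.restrict (Ioo a b))) :
    rlKernel α b a a * f x ^ 2 ≤
      (rlKernel α b a a * rlKernel α b x x - rlKernel α b a x ^ 2) *
        ∫ t in Ioo a b, rightCaputoDeriv α b f t ^ 2 := by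
  have hα0 : 0 < α := by linarith
  have ha : a ∈ Icc a b := left_mem_Icc.2 hab.le
  have hΓ := Real.Gamma_pos_of_pos hα0
  have hrepr : ∀ z ∈ Icc a b, ∫ t in Ioo a b, evalRepr α z t * rightCaputoDeriv α b f t = f z := by
    intro z hz
    rw [integral_evalRepr_mul α hz]
    simp_rw [div_mul_eq_mul_div]
    rw [intervalIntegral.integral_div, integral_rpow_mul_rightCaputoDeriv hα0 hα1 hz hf hfb]
    field_simp
  set A := rlKernel α b a a with hA
  set B := rlKernel α b a x with hB
  set C := rlKernel α b x x with hC
  have hApos : 0 < A := rlKernel_self_pos hα hab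
  have hea := memLp_evalRepr hα ha
  have hex := memLp_evalRepr hα hx
  have hg := (hex.const_mul A).sub (hea.const_mul B)
  have hCS := sq_integral_mul_le_integral_sq_mul hg hw
  have hxw : IntegrableOn (fun t => evalRepr α x t * rightCaputoDeriv α b f t) (Ioo a b) :=
    hex.integrable_mul hw
  have haw : IntegrableOn (fun t => evalRepr α a t * rightCaputoDeriv α b f t) (Ioo a b) :=
    hea.integrable_mul hw
  have hxx : IntegrableOn (fun t => evalRepr α x t * evalRepr α x t) (Ioo a b) :=
    hex.integrable_mul hex
  have hax : IntegrableOn (fun t => evalRepr α a t * evalRepr α x t) (Ioo a b) :=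
    hea.integrable_mul hex
  have haa : IntegrableOn (fun t => evalRepr α a t * evalRepr α a t) (Ioo a b) :=
    hea.integrable_mul hea
  have h1 : ∫ t in Ioo a b, ((fun t => A * evalRepr α x t) - fun t => B * evalRepr α a t) t *
      rightCaputoDeriv α b f t = A * f x := by
    have e : ∀ t, ((fun t => A * evalRepr α x t) - fun t => B * evalRepr α a t) t *
      rightCaputoDeriv α b f t = A * (evalRepr α x t * rightCaputoDeriv α b f t) -
        B * (evalRepr α a t * rightCaputoDeriv α b f t) := fun t => by
      simp only [Pi.sub_apply]; ring
    simp_rw [e]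
    rw [integral_sub (hxw.const_mul A) (haw.const_mul B),
      integral_const_mul, integral_const_mul, hrepr x hx, hrepr a ha, hfa]
    ring
  have h2 : ∫ t in Ioo a b, (((fun t => A * evalRepr α x t) - fun t => B * evalRepr α a t) t) ^ 2
      = A * (A * C - B ^ 2) := by
    have e : ∀ t, (((fun t => A * evalRepr α x t) - fun t => B * evalRepr α a t) t) ^ 2 =
        A ^ 2 * (evalRepr α x t * evalRepr α x t) - 2 * A * B * (evalRepr α a t * evalRepr α x t)
        + B ^ 2 * (evalRepr α a t * evalRepr α a t) := fun t => by simp only [Pi.sub_apply]; ring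
    simp_rw [e]
    have hsub : IntegrableOn (fun t => A ^ 2 * (evalRepr α x t * evalRepr α x t) -
        2 * A * B * (evalRepr α a t * evalRepr α x t)) (Ioo a b) :=
      (hxx.const_mul _).sub (hax.const_mul _)
    rw [integral_add hsub (haa.const_mul _), integral_sub (hxx.const_mul _) (hax.const_mul _),
      integral_const_mul, integral_const_mul, integral_const_mul,
      integral_evalRepr_mul_evalRepr α hx hx, integral_evalRepr_mul_evalRepr α ha hx,
      integral_evalRepr_mul_evalRepr α ha ha, ← hA, ← hB, ← hC]
    ring
  rw [h1, h2] at hCS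
  refine le_of_mul_le_mul_left ?_ hApos
  linarith

/-- The Gram determinant of `e_a` and `e_t` is bounded and measurable, so it preserves
integrability of weights. -/
theorem integrableOn_gramDet_mul {α a b : ℝ} (hα : 1 / 2 < α) (hab : a < b) {g : ℝ → ℝ}
    (hg : IntegrableOn g (Ioo a b)) :
    IntegrableOn (fun t => (rlKernel α b a a * rlKernel α b t t - rlKernel α b a t ^ 2) * g t)
      (Ioo a b) := by
  have ha : a ∈ Icc a b := left_mem_Icc.2 hab.le
  have hmeas : ∀ h : ℝ → ℝ, Measurable h → Measurable fun t =>
      ∫ r in Ioo a b, evalRepr α (h t) r * evalRepr α t r := by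
    intro h hh
    refine (StronglyMeasurable.integral_prod_right (f := fun t r =>
      evalRepr α (h t) r * evalRepr α t r) (Measurable.stronglyMeasurable ?_)).measurable
    exact ((measurable_evalRepr α).comp ((hh.comp measurable_fst).prodMk measurable_snd)).mul
      (measurable_evalRepr α)
  have hm : AEStronglyMeasurable (fun t => rlKernel α b a a * rlKernel α b t t -
      rlKernel α b a t ^ 2) (volume.restrict (Ioo a b)) := by
    refine (Measurable.aestronglyMeasurable (((hmeas id measurable_id).const_mul
      (rlKernel α b a a)).sub ((hmeas (fun _ => a) measurable_const).pow_const 2))).congr ?_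
    filter_upwards [ae_restrict_mem measurableSet_Ioo] with t ht
    have ht' := Ioo_subset_Icc_self ht
    simp only [id, Pi.sub_apply]
    rw [integral_evalRepr_mul_evalRepr α ht' ht', integral_evalRepr_mul_evalRepr α ha ht']
  refine Integrable.bdd_mul (c := rlKernel α b a a ^ 2) hg hm ?_
  filter_upwards [ae_restrict_mem measurableSet_Ioo] with t ht
  have ht' := Ioo_subset_Icc_self ht
  have hA := rlKernel_self_pos hα hab
  have hC : rlKernel α b t t ≤ rlKernel α b a a := by
    have hΓ := Real.Gamma_pos_of_pos (show 0 < α by linarith)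
    have h1 : 0 < 2 * α - 1 := by linarith
    rw [rlKernel_self hα ht.2.le, rlKernel_self hα hab.le]
    have := ht.1; have := ht.2
    gcongr
  have hCS := sq_integral_mul_le_integral_sq_mul (memLp_evalRepr hα ha) (memLp_evalRepr hα ht')
  simp_rw [sq (evalRepr α _ _)] at hCS
  rw [integral_evalRepr_mul_evalRepr α ha ht', integral_evalRepr_mul_evalRepr α ha ha,
    integral_evalRepr_mul_evalRepr α ht' ht'] at hCS
  rw [Real.norm_of_nonneg (by linarith)]
  nlinarith [sq_nonneg (rlKernel α b a t)]

/-! ### The Gagliardo seminorm and Friedrichs' inequality -/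

/-- The difference quotient `(φ(y) - φ(z)) / |y - z|^{N/2 + s}`, whose `L²` norm is the Gagliardo
seminorm of order `s`. -/
noncomputable def diffQuot {N : ℕ} (s : ℝ) (φ : EuclideanSpace ℝ (Fin N) → ℝ)
    (p : EuclideanSpace ℝ (Fin N) × EuclideanSpace ℝ (Fin N)) : ℝ :=
  (φ p.1 - φ p.2) / ‖p.1 - p.2‖ ^ (((N : ℝ) + 2 * s) / 2)

/-- The square of the Gagliardo seminorm of order `s`. -/
noncomputable def gagliardoSq {N : ℕ} (s : ℝ) (φ : EuclideanSpace ℝ (Fin N) → ℝ) : ℝ :=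
  ∫ p, diffQuot s φ p ^ 2

section Energy

variable {N : ℕ} {s κ : ℝ} {Ω : Set (EuclideanSpace ℝ (Fin N))}
  {φ ψ : EuclideanSpace ℝ (Fin N) → ℝ}

theorem diffQuot_mul_diffQuot (s : ℝ) (φ ψ : EuclideanSpace ℝ (Fin N) → ℝ)
    (p : EuclideanSpace ℝ (Fin N) × EuclideanSpace ℝ (Fin N)) :
    diffQuot s φ p * diffQuot s ψ p =
      (φ p.1 - φ p.2) * (ψ p.1 - ψ p.2) / ‖p.1 - p.2‖ ^ ((N : ℝ) + 2 * s) := by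
  rw [diffQuot, diffQuot, div_mul_div_comm, ← sq, ← Real.rpow_natCast, ← Real.rpow_mul
    (norm_nonneg _)]
  congr 2
  push_cast; ring

theorem fracForm_eq_integral_diffQuot (κ s : ℝ) (φ ψ : EuclideanSpace ℝ (Fin N) → ℝ) :
    fracForm κ s φ ψ = κ / 2 * ∫ p, diffQuot s φ p * diffQuot s ψ p := by
  simp_rw [diffQuot_mul_diffQuot]
  rfl

theorem fracForm_self (κ s : ℝ) (φ : EuclideanSpace ℝ (Fin N) → ℝ) :
    fracForm κ s φ φ = κ / 2 * gagliardoSq s φ := by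
  rw [fracForm_eq_integral_diffQuot, gagliardoSq]
  simp_rw [sq]

theorem gagliardoSq_nonneg (s : ℝ) (φ : EuclideanSpace ℝ (Fin N) → ℝ) : 0 ≤ gagliardoSq s φ :=
  integral_nonneg fun _ => sq_nonneg _

theorem diffQuot_add_mul (s t : ℝ) (φ ψ : EuclideanSpace ℝ (Fin N) → ℝ)
    (p : EuclideanSpace ℝ (Fin N) × EuclideanSpace ℝ (Fin N)) :
    diffQuot s (fun y => φ y + t * ψ y) p = diffQuot s φ p + t * diffQuot s ψ p := by
  simp only [diffQuot]; ring

theorem aestronglyMeasurable_diffQuot (s : ℝ) (hφ : AEStronglyMeasurable φ volume) :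
    AEStronglyMeasurable (diffQuot s φ) volume := by
  have h1 : AEStronglyMeasurable (fun p : EuclideanSpace ℝ (Fin N) × EuclideanSpace ℝ (Fin N) =>
      φ p.1 - φ p.2) (volume.prod volume) := hφ.comp_fst.sub hφ.comp_snd
  have h2 : Measurable (fun p : EuclideanSpace ℝ (Fin N) × EuclideanSpace ℝ (Fin N) =>
      ‖p.1 - p.2‖ ^ (((N : ℝ) + 2 * s) / 2)) := by fun_prop
  exact (h1.aemeasurable.div h2.aemeasurable).aestronglyMeasurable

theorem memFracEnergy_iff_memLp_diffQuot : MemFracEnergy s Ω φ ↔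
    MemLp φ 2 volume ∧ (∀ y ∉ Ω, φ y = 0) ∧ MemLp (diffQuot s φ) 2 volume := by
  have key : MemLp φ 2 volume → (MemLp (diffQuot s φ) 2 volume ↔ Integrable
      (fun p : EuclideanSpace ℝ (Fin N) × EuclideanSpace ℝ (Fin N) =>
      (φ p.1 - φ p.2) ^ 2 / ‖p.1 - p.2‖ ^ ((N : ℝ) + 2 * s)) (volume.prod volume)) := by
    intro h
    rw [memLp_two_iff_integrable_sq (aestronglyMeasurable_diffQuot s h.1)]
    simp_rw [sq, diffQuot_mul_diffQuot]
    rfl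
  exact ⟨fun h => ⟨h.1, h.2, (key h.1).2 h.3⟩, fun h => ⟨h.1, h.2.1, (key h.1).1 h.2.2⟩⟩

theorem MemFracEnergy.memLp_diffQuot (h : MemFracEnergy s Ω φ) : MemLp (diffQuot s φ) 2 volume :=
  (memFracEnergy_iff_memLp_diffQuot.1 h).2.2

theorem MemFracEnergy.add_mul (hφ : MemFracEnergy s Ω φ) (hψ : MemFracEnergy s Ω ψ) (t : ℝ) :
    MemFracEnergy s Ω (fun y => φ y + t * ψ y) := by
  refine memFracEnergy_iff_memLp_diffQuot.2 ⟨hφ.1.add (hψ.1.const_mul t), fun y hy => ?_, ?_⟩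
  · simp [hφ.2 y hy, hψ.2 y hy]
  · rw [show diffQuot s (fun y => φ y + t * ψ y) = _ from funext (diffQuot_add_mul s t φ ψ)]
    exact hφ.memLp_diffQuot.add (hψ.memLp_diffQuot.const_mul t)

/-- Expansion of `‖f + t g‖²` in `L²`. -/
theorem integral_add_mul_sq {X : Type*} [MeasurableSpace X] {μ : Measure X} {f g : X → ℝ}
    (hf : MemLp f 2 μ) (hg : MemLp g 2 μ) (t : ℝ) :
    ∫ x, (f x + t * g x) ^ 2 ∂μ =
      (∫ x, f x ^ 2 ∂μ) + 2 * t * (∫ x, f x * g x ∂μ) + t ^ 2 * ∫ x, g x ^ 2 ∂μ := by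
  have hfg : Integrable (fun x => f x * g x) μ := hf.integrable_mul hg
  have h1 : Integrable (fun x => f x ^ 2 + 2 * t * (f x * g x)) μ :=
    hf.integrable_sq.add (hfg.const_mul _)
  rw [← integral_const_mul, ← integral_const_mul, ← integral_add hf.integrable_sq
    (hfg.const_mul _), ← integral_add h1 (hg.integrable_sq.const_mul _)]
  congr 1; ext x; ring

theorem gagliardoSq_add_mul (hφ : MemFracEnergy s Ω φ) (hψ : MemFracEnergy s Ω ψ) (t : ℝ) :
    gagliardoSq s (fun y => φ y + t * ψ y) = gagliardoSq s φ +
      2 * t * (∫ p, diffQuot s φ p * diffQuot s ψ p) + t ^ 2 * gagliardoSq s ψ := by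
  simp_rw [gagliardoSq, diffQuot_add_mul]
  exact integral_add_mul_sq hφ.memLp_diffQuot hψ.memLp_diffQuot t

theorem gagliardoSq_mul (s t : ℝ) (φ : EuclideanSpace ℝ (Fin N) → ℝ) :
    gagliardoSq s (fun y => t * φ y) = t ^ 2 * gagliardoSq s φ := by
  rw [gagliardoSq, gagliardoSq, ← integral_const_mul]
  congr 1; ext p
  simp only [diffQuot]; ring

theorem gagliardoSq_sub_le (hφ : MemFracEnergy s Ω φ) (hψ : MemFracEnergy s Ω ψ) :
    gagliardoSq s (fun y => φ y + (-1) * ψ y) ≤ 2 * gagliardoSq s φ + 2 * gagliardoSq s ψ := by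
  have h1 := gagliardoSq_add_mul hφ hψ 1
  have h2 := gagliardoSq_add_mul hφ hψ (-1)
  have h3 := gagliardoSq_nonneg s (fun y => φ y + 1 * ψ y)
  linarith

/-- The variance identity `μ(X) ∫ f² = (∫ f)² + ½ ∬ (f(x) - f(y))²` on a finite measure space. -/
theorem measureReal_univ_mul_integral_sq {X : Type*} [MeasurableSpace X] {μ : Measure X}
    [IsFiniteMeasure μ] {f : X → ℝ} (hf : MemLp f 2 μ) :
    μ.real univ * ∫ x, f x ^ 2 ∂μ =
      (∫ x, f x ∂μ) ^ 2 + 1 / 2 * ∫ p : X × X, (f p.1 - f p.2) ^ 2 ∂(μ.prod μ) := by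
  have h1 : Integrable f μ := hf.integrable one_le_two
  have h2 := hf.integrable_sq
  have i1 : Integrable (fun p : X × X => f p.1 ^ 2) (μ.prod μ) := h2.comp_fst μ
  have i2 : Integrable (fun p : X × X => f p.2 ^ 2) (μ.prod μ) := h2.comp_snd μ
  have i3 : Integrable (fun p : X × X => f p.1 * f p.2) (μ.prod μ) := h1.mul_prod h1
  have i4 : Integrable (fun p : X × X => f p.1 ^ 2 + f p.2 ^ 2) (μ.prod μ) := i1.add i2
  have e : ∀ p : X × X, (f p.1 - f p.2) ^ 2 = f p.1 ^ 2 + f p.2 ^ 2 - 2 * (f p.1 * f p.2) :=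
    fun p => by ring
  simp_rw [e]
  rw [integral_sub i4 (i3.const_mul 2), integral_add i1 i2, integral_const_mul,
    integral_prod_mul f f, integral_fun_fst (fun x => f x ^ 2),
    integral_fun_snd (fun x => f x ^ 2)]
  simp only [smul_eq_mul]
  ring

/-- The half-open grid cube `∏ᵢ (νᵢ / n, (νᵢ + 1) / n]` of side `1 / n` with index `ν`. -/
def gridCube (N n : ℕ) [NeZero n] (ν : Fin N → ℤ) : Set (EuclideanSpace ℝ (Fin N)) :=
  WithLp.ofLp ⁻¹' (BoxIntegral.unitPartition.box n ν : Set (Fin N → ℝ))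

theorem measurableSet_gridCube (n : ℕ) [NeZero n] (ν : Fin N → ℤ) :
    MeasurableSet (gridCube N n ν) :=
  (PiLp.volume_preserving_ofLp (Fin N)).measurable
    (BoxIntegral.unitPartition.box n ν).measurableSet_coe

theorem volume_gridCube (n : ℕ) [NeZero n] (ν : Fin N → ℤ) :
    volume (gridCube N n ν) = 1 / (n : ENNReal) ^ N := by
  rw [gridCube, (PiLp.volume_preserving_ofLp (Fin N)).measure_preimage
    (BoxIntegral.unitPartition.box n ν).measurableSet_coe.nullMeasurableSet,
    BoxIntegral.unitPartition.volume_box, Fintype.card_fin]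

theorem isFiniteMeasure_restrict_gridCube (n : ℕ) [NeZero n] (ν : Fin N → ℤ) :
    IsFiniteMeasure (volume.restrict (gridCube N n ν)) := by
  refine ⟨?_⟩
  have h : (0 : ENNReal) < (n : ENNReal) ^ N :=
    ENNReal.pow_pos (by exact_mod_cast NeZero.pos n) N
  rw [Measure.restrict_apply_univ, volume_gridCube, one_div, ENNReal.inv_lt_top]
  exact h

theorem disjoint_gridCube (n : ℕ) [NeZero n] {ν ν' : Fin N → ℤ} (h : ν ≠ ν') :
    Disjoint (gridCube N n ν) (gridCube N n ν') :=
  (BoxIntegral.unitPartition.disjoint.1 h).preimage _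

theorem norm_sub_le_of_mem_gridCube {n : ℕ} [NeZero n] {ν : Fin N → ℤ}
    {y z : EuclideanSpace ℝ (Fin N)} (hy : y ∈ gridCube N n ν) (hz : z ∈ gridCube N n ν) :
    ‖y - z‖ ≤ √N / n := by
  have hn : (0 : ℝ) < n := Nat.cast_pos.2 (NeZero.pos n)
  have h : ∀ i, ‖(y - z) i‖ ≤ 1 / n := by
    intro i
    have h1 := BoxIntegral.unitPartition.mem_box_iff.1 hy i
    have h2 := BoxIntegral.unitPartition.mem_box_iff.1 hz i
    rw [Real.norm_eq_abs, PiLp.sub_apply, abs_le, ← neg_div]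
    simp only [neg_div]
    rw [add_div] at h1 h2
    constructor <;> linarith [h1.1, h1.2, h2.1, h2.2]
  rw [EuclideanSpace.norm_eq, Real.sqrt_le_iff]
  refine ⟨by positivity, (Finset.sum_le_sum fun i _ =>
    pow_le_pow_left₀ (norm_nonneg _) (h i) 2).trans ?_⟩
  simp [div_pow]
  exact le_of_eq (by ring)

/-- A bounded set meets finitely many cubes of the grid. -/
theorem exists_finset_gridCube_cover (n : ℕ) [NeZero n] (hΩ : Bornology.IsBounded Ω) :
    ∃ K : Finset (Fin N → ℤ), ∀ y ∈ Ω, ∃ ν ∈ K, y ∈ gridCube N n ν := by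
  obtain ⟨R, hR⟩ := hΩ.exists_norm_le
  refine ⟨Finset.Icc (fun _ => ⌈(n : ℝ) * -R⌉ - 1) (fun _ => ⌈(n : ℝ) * R⌉ - 1), fun y hy =>
    ⟨BoxIntegral.unitPartition.index n (WithLp.ofLp y), ?_, ?_⟩⟩
  · have h : ∀ i, -R ≤ y i ∧ y i ≤ R := fun i =>
      abs_le.1 ((PiLp.norm_apply_le y i).trans (hR y hy))
    rw [Finset.mem_Icc]
    constructor <;> intro i <;> simp only [BoxIntegral.unitPartition.index_apply] <;>
      gcongr
    · exact (h i).1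
    · exact (h i).2
  · exact BoxIntegral.unitPartition.mem_box_iff_index.2 rfl

/-- Poincaré inequality on a cube, in the form adapted to the Gagliardo seminorm. -/
theorem setIntegral_gridCube_sq_le (hs : 0 ≤ s) (n : ℕ) [NeZero n] (hφ : MemFracEnergy s Ω φ)
    (ν : Fin N → ℤ) :
    ∫ y in gridCube N n ν, φ y ^ 2 ≤ (n : ℝ) ^ N * (∫ y in gridCube N n ν, φ y) ^ 2 +
      (n : ℝ) ^ N * (√N / n) ^ ((N : ℝ) + 2 * s) *
        ∫ p in gridCube N n ν ×ˢ gridCube N n ν, diffQuot s φ p ^ 2 := by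
  set Q := gridCube N n ν with hQ
  have hQm : MeasurableSet Q := measurableSet_gridCube n ν
  have hn : (0 : ℝ) < n := Nat.cast_pos.2 (NeZero.pos n)
  have hvol : volume Q = 1 / (n : ENNReal) ^ N := volume_gridCube n ν
  have hvol' : volume.real Q = 1 / (n : ℝ) ^ N := by
    rw [Measure.real, hvol]; simp
  have hfin := isFiniteMeasure_restrict_gridCube n ν
  have h := measureReal_univ_mul_integral_sq (hφ.memLp.restrict Q)
  rw [measureReal_restrict_apply_univ, hvol', Measure.prod_restrict] at h
  set d : ℝ := (√N / n) ^ ((N : ℝ) + 2 * s) with hd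
  have hd0 : 0 ≤ d := by positivity
  have hI : IntegrableOn (fun p => diffQuot s φ p ^ 2) (Q ×ˢ Q) :=
    hφ.memLp_diffQuot.integrable_sq.integrableOn
  have hle : ∫ p in Q ×ˢ Q, (φ p.1 - φ p.2) ^ 2 ∂(volume.prod volume) ≤
      d * ∫ p in Q ×ˢ Q, diffQuot s φ p ^ 2 := by
    rw [← integral_const_mul]
    refine integral_mono_of_nonneg (ae_of_all _ fun p => sq_nonneg _) (hI.const_mul d) ?_
    refine (ae_restrict_mem (hQm.prod hQm)).mono fun p hp => ?_
    simp only []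
    rw [sq, sq, diffQuot_mul_diffQuot]
    rcases eq_or_ne p.1 p.2 with he | hne
    · simp [he]
    · have hpos : 0 < ‖p.1 - p.2‖ := norm_pos_iff.2 (sub_ne_zero.2 hne)
      have hp' : 0 < ‖p.1 - p.2‖ ^ ((N : ℝ) + 2 * s) := Real.rpow_pos_of_pos hpos _
      rw [mul_div_assoc', le_div_iff₀ hp', mul_comm]
      refine mul_le_mul_of_nonneg_right ?_ (mul_self_nonneg _)
      exact Real.rpow_le_rpow hpos.le (norm_sub_le_of_mem_gridCube hp.1 hp.2) (by positivity)
  have h0 : 0 ≤ ∫ p in Q ×ˢ Q, diffQuot s φ p ^ 2 := integral_nonneg fun _ => sq_nonneg _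
  have hnN : (0 : ℝ) < (n : ℝ) ^ N := by positivity
  have h2 : ∫ y in Q, φ y ^ 2 = (n : ℝ) ^ N * ((∫ y in Q, φ y) ^ 2 +
      1 / 2 * ∫ p in Q ×ˢ Q, (φ p.1 - φ p.2) ^ 2 ∂(volume.prod volume)) := by
    rw [← h]; field_simp
  rw [h2, mul_add, mul_assoc]
  refine add_le_add_right (mul_le_mul_of_nonneg_left ?_ hnN.le) _
  linarith [mul_nonneg hd0 h0]

/-- Friedrichs' inequality: the `L²` norm is controlled by finitely many averages, up to an
arbitrarily small multiple of the Gagliardo seminorm. This is what makes the embedding of the energy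
space into `L²` compact. -/
theorem exists_friedrichs (hs : 0 < s) (hΩ : Bornology.IsBounded Ω) {ε : ℝ} (hε : 0 < ε) :
    ∃ (K : Finset (Fin N → ℤ)) (n : ℕ) (_ : NeZero n),
      ∀ φ : EuclideanSpace ℝ (Fin N) → ℝ, MemFracEnergy s Ω φ →
        ∫ y, φ y ^ 2 ≤ (n : ℝ) ^ N * ∑ ν ∈ K, (∫ y in gridCube N n ν, φ y) ^ 2 +
          ε * gagliardoSq s φ := by
  have hlim : Filter.Tendsto (fun n : ℕ => (√N) ^ ((N : ℝ) + 2 * s) * (n : ℝ) ^ (-(2 * s)))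
      Filter.atTop (𝓝 0) := by
    have := ((tendsto_rpow_neg_atTop (show 0 < 2 * s by linarith)).comp
      (tendsto_natCast_atTop_atTop (R := ℝ))).const_mul ((√N) ^ ((N : ℝ) + 2 * s))
    simpa using this
  obtain ⟨n, hnε, hn1⟩ := ((hlim.eventually_lt_const hε).and
    (Filter.eventually_ge_atTop 1)).exists
  have hne : NeZero n := ⟨by omega⟩
  have hn : (0 : ℝ) < n := Nat.cast_pos.2 (NeZero.pos n)
  obtain ⟨K, hK⟩ := exists_finset_gridCube_cover n hΩ
  refine ⟨K, n, hne, fun φ hφ => ?_⟩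
  have hcoef : (n : ℝ) ^ N * (√N / n) ^ ((N : ℝ) + 2 * s) ≤ ε := by
    refine le_trans (le_of_eq ?_) hnε.le
    rw [Real.div_rpow (by positivity) hn.le, Real.rpow_add hn, Real.rpow_natCast,
      Real.rpow_neg hn.le]
    field_simp
  have h1 : ∫ y, φ y ^ 2 = ∑ ν ∈ K, ∫ y in gridCube N n ν, φ y ^ 2 := by
    rw [← integral_biUnion_finset K (fun ν _ => measurableSet_gridCube n ν)
      (fun ν _ ν' _ h => disjoint_gridCube n h) (fun ν _ => hφ.memLp.integrable_sq.integrableOn)]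
    refine (setIntegral_eq_integral_of_forall_compl_eq_zero fun y hy => ?_).symm
    rw [hφ.eq_zero y fun hyΩ => hy ?_, sq, zero_mul]
    obtain ⟨ν, hν, hyν⟩ := hK y hyΩ
    exact mem_biUnion hν hyν
  have h2 : ∑ ν ∈ K, ∫ p in gridCube N n ν ×ˢ gridCube N n ν, diffQuot s φ p ^ 2 ≤
      gagliardoSq s φ := by
    rw [← integral_biUnion_finset K
      (fun ν _ => (measurableSet_gridCube n ν).prod (measurableSet_gridCube n ν))
      (fun ν _ ν' _ h => Disjoint.set_prod_left (disjoint_gridCube n h) _ _)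
      (fun ν _ => hφ.memLp_diffQuot.integrable_sq.integrableOn)]
    exact setIntegral_le_integral hφ.memLp_diffQuot.integrable_sq
      (ae_of_all _ fun _ => sq_nonneg _)
  rw [h1]
  refine (Finset.sum_le_sum fun ν _ => setIntegral_gridCube_sq_le hs.le n hφ ν).trans ?_
  rw [Finset.sum_add_distrib, ← Finset.mul_sum, ← Finset.mul_sum]
  gcongr

end Energy

/-! ### Rellich's theorem and the first eigenvalue -/

section Spectrum

variable {N : ℕ} {s κ : ℝ} {Ω : Set (EuclideanSpace ℝ (Fin N))}
  {φ ψ : EuclideanSpace ℝ (Fin N) → ℝ}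

/-- The classes in `L²` of the functions of energy at most `M` in the unit ball of `L²`. -/
def energyBall (s : ℝ) (Ω : Set (EuclideanSpace ℝ (Fin N))) (M : ℝ) :
    Set (Lp ℝ 2 (volume : Measure (EuclideanSpace ℝ (Fin N)))) :=
  {f | ∃ φ, MemFracEnergy s Ω φ ∧ f =ᵐ[volume] φ ∧ ∫ y, φ y ^ 2 ≤ 1 ∧ gagliardoSq s φ ≤ M}

theorem norm_sq_eq_integral {X : Type*} [MeasurableSpace X] {μ : Measure X} (f : Lp ℝ 2 μ) :
    ‖f‖ ^ 2 = ∫ x, f x ^ 2 ∂μ := by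
  rw [← real_inner_self_eq_norm_sq, L2.inner_def]
  simp [sq]

/-- Rellich's theorem for the fractional energy space. -/
theorem totallyBounded_energyBall (hs : 0 < s) (hΩ : Bornology.IsBounded Ω) (M : ℝ) :
    TotallyBounded (energyBall s Ω M) := by
  refine Metric.totallyBounded_of_finite_discretization fun ε hε => ?_
  set M' : ℝ := 4 * |M| + 1 with hM'
  have hM'0 : 0 < M' := by positivity
  obtain ⟨K, n, hn0, hF⟩ := exists_friedrichs hs hΩ (show 0 < ε ^ 2 / (2 * M') by positivity)
  have hn : (0 : ℝ) < n := Nat.cast_pos.2 (NeZero.pos n)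
  set A : Lp ℝ 2 (volume : Measure (EuclideanSpace ℝ (Fin N))) → (K → ℝ) :=
    fun f ν => ∫ y in gridCube N n ν, f y with hA
  have hvol : ∀ ν, volume.real (gridCube N n ν) ≤ 1 := by
    intro ν
    rw [Measure.real, volume_gridCube]
    simp only [one_div, ENNReal.toReal_inv, ENNReal.toReal_pow, ENNReal.toReal_natCast]
    exact inv_le_one_of_one_le₀ (one_le_pow₀ (by exact_mod_cast NeZero.one_le))
  have hbdd : ∀ f ∈ energyBall s Ω M, A f ∈ Metric.closedBall (0 : K → ℝ) 1 := by
    rintro f ⟨φ, hφ, hfφ, h1, -⟩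
    rw [mem_closedBall_zero_iff, pi_norm_le_iff_of_nonneg zero_le_one]
    intro ν
    have hfin := isFiniteMeasure_restrict_gridCube n (ν : Fin N → ℤ)
    have hCS := sq_integral_mul_le_integral_sq_mul (hφ.memLp.restrict (gridCube N n ν))
      (memLp_const (1 : ℝ))
    have h2 : ∫ y in gridCube N n ν, φ y ^ 2 ≤ 1 :=
      (setIntegral_le_integral hφ.memLp.integrable_sq (ae_of_all _ fun _ => sq_nonneg _)).trans h1
    have h3 : ∫ y in gridCube N n ν, f y = ∫ y in gridCube N n ν, φ y :=
      integral_congr_ae (ae_restrict_of_ae hfφ)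
    simp only [mul_one, one_pow, integral_const, smul_eq_mul, measureReal_restrict_apply_univ]
      at hCS
    have h4 : 0 ≤ ∫ y in gridCube N n ν, φ y ^ 2 := integral_nonneg fun _ => sq_nonneg _
    rw [hA, Real.norm_eq_abs, ← sq_le_one_iff_abs_le_one]
    simp only [h3]
    nlinarith [hvol ν, measureReal_nonneg (μ := volume) (s := gridCube N n ν)]
  -- Points whose averages are within `2 δ` of each other are within `ε` in `L²`.
  obtain ⟨δ, hδ, hδε⟩ : ∃ δ > 0, (n : ℝ) ^ N * (K.card * (2 * δ) ^ 2) < ε ^ 2 / 2 := by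
    have hc : Filter.Tendsto (fun δ : ℝ => (n : ℝ) ^ N * (K.card * (2 * δ) ^ 2)) (𝓝[>] 0)
        (𝓝 0) := by
      have : Continuous (fun δ : ℝ => (n : ℝ) ^ N * (K.card * (2 * δ) ^ 2)) := by fun_prop
      have h := this.tendsto 0
      simp only [mul_zero, ne_eq, OfNat.ofNat_ne_zero, not_false_eq_true, zero_pow] at h
      exact h.mono_left nhdsWithin_le_nhds
    obtain ⟨δ, h1, h2⟩ := ((hc.eventually_lt_const (show 0 < ε ^ 2 / 2 by positivity)).and
      self_mem_nhdsWithin).exists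
    exact ⟨δ, h2, h1⟩
  obtain ⟨t, htfin, ht⟩ := Metric.totallyBounded_iff.1
    (isCompact_closedBall (0 : K → ℝ) 1).totallyBounded δ hδ
  have hex : ∀ f : energyBall s Ω M, ∃ c : t, dist (A f) c < δ := by
    intro f
    obtain ⟨c, hc, hfc⟩ := mem_iUnion₂.1 (ht (hbdd f f.2))
    exact ⟨⟨c, hc⟩, hfc⟩
  choose F hFd using hex
  have : Fintype t := htfin.fintype
  refine ⟨ULift (Fin (Fintype.card t)), inferInstance,
    fun f => ⟨Fintype.equivFin t (F f)⟩, fun f g hfg => ?_⟩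
  have hfg' : F f = F g := by simpa using hfg
  have hd : dist (A f) (A g) < 2 * δ := by
    have h1 := hFd f
    have h2 := hFd g
    rw [← hfg'] at h2
    linarith [dist_triangle_right (A f) (A g) (F f)]
  obtain ⟨φ, hφ, hfφ, -, hφM⟩ := f.2
  obtain ⟨ψ, hψ, hgψ, -, hψM⟩ := g.2
  have h1 := hF _ (hφ.add_mul hψ (-1))
  have h2 : ‖(f : Lp ℝ 2 (volume : Measure (EuclideanSpace ℝ (Fin N)))) - g‖ ^ 2 =
      ∫ y, (φ y + -1 * ψ y) ^ 2 := by
    rw [norm_sq_eq_integral]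
    refine integral_congr_ae ?_
    filter_upwards [Lp.coeFn_sub (f : Lp ℝ 2 (volume : Measure (EuclideanSpace ℝ (Fin N)))) g,
      hfφ, hgψ] with y hy1 hy2 hy3
    rw [hy1, Pi.sub_apply, hy2, hy3]; ring
  have h3 : ∑ ν ∈ K, (∫ y in gridCube N n ν, (φ y + -1 * ψ y)) ^ 2 ≤ K.card * (2 * δ) ^ 2 := by
    rw [← nsmul_eq_mul]
    refine Finset.sum_le_card_nsmul _ _ _ fun ν hν => ?_
    have hfin := isFiniteMeasure_restrict_gridCube n ν
    have h4 : ∫ y in gridCube N n ν, (φ y + -1 * ψ y) = A f ⟨ν, hν⟩ - A g ⟨ν, hν⟩ := by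
      simp only [hA]
      rw [integral_congr_ae (ae_restrict_of_ae hfφ), integral_congr_ae (ae_restrict_of_ae hgψ),
        ← integral_sub ((hφ.memLp.restrict _).integrable one_le_two)
          ((hψ.memLp.restrict _).integrable one_le_two)]
      congr 1; ext y; ring
    rw [h4, ← sq_abs, ← Real.dist_eq]
    exact pow_le_pow_left₀ dist_nonneg ((dist_le_pi_dist _ _ _).trans hd.le) 2
  have h5 : ε ^ 2 / (2 * M') * gagliardoSq s (fun y => φ y + -1 * ψ y) ≤ ε ^ 2 / 2 := by
    have h6 := gagliardoSq_sub_le hφ hψ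
    have h7 : gagliardoSq s (fun y => φ y + -1 * ψ y) ≤ M' := by
      have := le_abs_self M
      linarith
    calc _ ≤ ε ^ 2 / (2 * M') * M' := by gcongr
      _ = ε ^ 2 / 2 := by field_simp
  rw [dist_eq_norm]
  refine lt_of_pow_lt_pow_left₀ 2 hε.le ?_
  rw [h2]
  have h8 := mul_le_mul_of_nonneg_left h3 (show 0 ≤ (n : ℝ) ^ N by positivity)
  linarith

/-- The Rayleigh quotient attains its infimum `m`: a minimizing sequence converges in `L²` along a
subsequence by Rellich's theorem, and the energy of the limit is at most `m` by Fatou's lemma. -/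
theorem exists_isLeast_gagliardoSq (hs : 0 < s) (hΩ : Bornology.IsBounded Ω)
    (hne : ∃ φ : EuclideanSpace ℝ (Fin N) → ℝ, MemFracEnergy s Ω φ ∧ ∫ y, φ y ^ 2 = 1) :
    ∃ m, IsLeast {e | ∃ φ : EuclideanSpace ℝ (Fin N) → ℝ,
      MemFracEnergy s Ω φ ∧ ∫ y, φ y ^ 2 = 1 ∧ gagliardoSq s φ = e} m := by
  set S := {e | ∃ φ : EuclideanSpace ℝ (Fin N) → ℝ,
      MemFracEnergy s Ω φ ∧ ∫ y, φ y ^ 2 = 1 ∧ gagliardoSq s φ = e} with hS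
  have hSne : S.Nonempty := by
    obtain ⟨φ, h1, h2⟩ := hne
    exact ⟨_, φ, h1, h2, rfl⟩
  have hSbdd : BddBelow S := ⟨0, by rintro _ ⟨φ, -, -, rfl⟩; exact gagliardoSq_nonneg s φ⟩
  refine ⟨sInf S, ?_, fun e he => csInf_le hSbdd he⟩
  obtain ⟨e, -, hetend, heS⟩ := exists_seq_tendsto_sInf hSne hSbdd
  choose φ hφ hφ1 hφe using heS
  obtain ⟨M, hM⟩ := hetend.bddAbove_range
  set f : ℕ → Lp ℝ 2 (volume : Measure (EuclideanSpace ℝ (Fin N))) :=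
    fun k => (hφ k).memLp.toLp with hf
  have hfφ : ∀ k, f k =ᵐ[volume] φ k := fun k => (hφ k).memLp.coeFn_toLp
  have hfmem : ∀ k, f k ∈ closure (energyBall s Ω M) := fun k =>
    subset_closure ⟨φ k, hφ k, hfφ k, (hφ1 k).le, (hφe k).trans_le (hM ⟨k, rfl⟩)⟩
  obtain ⟨g, -, σ, hσ, hg⟩ := (TotallyBounded.isCompact_of_isComplete
    (totallyBounded_energyBall hs hΩ M).closure isClosed_closure.isComplete).tendsto_subseq hfmem
  have hgnorm : ∫ y, g y ^ 2 = 1 := by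
    rw [← norm_sq_eq_integral]
    refine tendsto_nhds_unique (hg.norm.pow 2) (tendsto_const_nhds.congr fun k => ?_)
    rw [Function.comp_apply, norm_sq_eq_integral, ← hφ1 (σ k)]
    exact integral_congr_ae ((hfφ (σ k)).fun_comp (· ^ 2)).symm
  obtain ⟨τ, hτ, hae⟩ := (tendstoInMeasure_of_tendsto_Lp hg).exists_seq_tendsto_ae
  set ρ : ℕ → ℕ := fun k => σ (τ k) with hρ
  have hρt : Filter.Tendsto ρ Filter.atTop Filter.atTop := hσ.tendsto_atTop.comp hτ.tendsto_atTop
  -- The limit vanishes a.e. outside `Ω`, where it may be redefined to be zero.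
  set χ : EuclideanSpace ℝ (Fin N) → ℝ := Ω.indicator g with hχ
  have hlim : ∀ᵐ y, Filter.Tendsto (fun k => φ (ρ k) y) Filter.atTop (𝓝 (χ y)) := by
    filter_upwards [hae, ae_all_iff.2 hfφ] with y hy hyφ
    by_cases hyΩ : y ∈ Ω
    · have : χ y = g y := indicator_of_mem hyΩ g
      rw [this]
      simpa [hyφ] using hy
    · have : χ y = 0 := indicator_of_notMem hyΩ g
      rw [this]
      exact tendsto_const_nhds.congr fun k => ((hφ (ρ k)).eq_zero y hyΩ).symm
  have hχg : χ =ᵐ[volume] g := by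
    filter_upwards [hae, ae_all_iff.2 hfφ, hlim] with y hy hyφ hyl
    refine tendsto_nhds_unique hyl ?_
    simpa [hyφ] using hy
  have hχL : MemLp χ 2 volume := (memLp_congr_ae hχg).2 (Lp.memLp g)
  have hlim2 : ∀ᵐ p : EuclideanSpace ℝ (Fin N) × EuclideanSpace ℝ (Fin N),
      Filter.Tendsto (fun k => ENNReal.ofReal (diffQuot s (φ (ρ k)) p ^ 2)) Filter.atTop
        (𝓝 (ENNReal.ofReal (diffQuot s χ p ^ 2))) := by
    filter_upwards [Measure.quasiMeasurePreserving_fst.ae hlim,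
      Measure.quasiMeasurePreserving_snd.ae hlim] with p h1 h2
    exact ENNReal.tendsto_ofReal (((h1.sub h2).div_const _).pow 2)
  have hmeas := aestronglyMeasurable_diffQuot s hχL.1
  have hfatou : ∫⁻ p, ENNReal.ofReal (diffQuot s χ p ^ 2) ≤ ENNReal.ofReal (sInf S) := by
    have h1 : ∀ k, ∫⁻ p, ENNReal.ofReal (diffQuot s (φ (ρ k)) p ^ 2) =
        ENNReal.ofReal (e (ρ k)) := by
      intro k
      rw [← hφe (ρ k), gagliardoSq, ofReal_integral_eq_lintegral_ofReal
        (hφ (ρ k)).memLp_diffQuot.integrable_sq (ae_of_all _ fun _ => sq_nonneg _)]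
    calc ∫⁻ p, ENNReal.ofReal (diffQuot s χ p ^ 2)
        = ∫⁻ p, Filter.liminf (fun k => ENNReal.ofReal (diffQuot s (φ (ρ k)) p ^ 2))
            Filter.atTop := lintegral_congr_ae (hlim2.mono fun p hp => hp.liminf_eq.symm)
      _ ≤ Filter.liminf (fun k => ∫⁻ p, ENNReal.ofReal (diffQuot s (φ (ρ k)) p ^ 2))
            Filter.atTop := lintegral_liminf_le' fun k =>
              (((hφ (ρ k)).memLp_diffQuot.1.aemeasurable).pow_const 2).ennreal_ofReal
      _ = ENNReal.ofReal (sInf S) := by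
          simp_rw [h1]
          exact (ENNReal.tendsto_ofReal (hetend.comp hρt)).liminf_eq
  have hint : Integrable (fun p => diffQuot s χ p ^ 2) volume := by
    refine ⟨(hmeas.aemeasurable.pow_const 2).aestronglyMeasurable, ?_⟩
    rw [hasFiniteIntegral_iff_ofReal (ae_of_all _ fun _ => sq_nonneg _)]
    exact hfatou.trans_lt ENNReal.ofReal_lt_top
  have hχmem : MemFracEnergy s Ω χ := memFracEnergy_iff_memLp_diffQuot.2
    ⟨hχL, fun y hy => indicator_of_notMem hy g, (memLp_two_iff_integrable_sq hmeas).2 hint⟩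
  have hχ1 : ∫ y, χ y ^ 2 = 1 := by
    rw [← hgnorm]
    exact integral_congr_ae (hχg.fun_comp (· ^ 2))
  refine ⟨χ, hχmem, hχ1, le_antisymm ?_ (csInf_le hSbdd ⟨χ, hχmem, hχ1, rfl⟩)⟩
  have h0 : 0 ≤ sInf S := le_csInf hSne (by rintro _ ⟨φ, -, -, rfl⟩; exact gagliardoSq_nonneg s φ)
  rw [gagliardoSq, integral_eq_lintegral_of_nonneg_ae (ae_of_all _ fun _ => sq_nonneg _) hint.1]
  exact ENNReal.toReal_le_of_le_ofReal h0 hfatou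

theorem integral_sq_pos_of_not_ae_zero (hφ : MemLp φ 2 volume) (h : ¬ φ =ᵐ[volume] 0) :
    0 < ∫ y, φ y ^ 2 := by
  refine (integral_nonneg fun _ => sq_nonneg _).lt_of_ne fun h0 => h ?_
  have := (integral_eq_zero_iff_of_nonneg (fun y => sq_nonneg (φ y)) hφ.integrable_sq).1 h0.symm
  filter_upwards [this] with y hy
  simpa using hy

theorem integral_sq_eq_zero_of_ae_zero (h : φ =ᵐ[volume] 0) : ∫ y, φ y ^ 2 = 0 :=
  integral_eq_zero_of_ae (h.mono fun y hy => by simp [hy])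

theorem eigenvalue_nonneg (hκ : 0 < κ) {μ : ℝ} (h : IsFracDirichletEigenvalue κ s Ω μ) :
    0 ≤ μ := by
  obtain ⟨φ, hφ, hne, h⟩ := h
  have h1 := h φ hφ
  rw [fracForm_self] at h1
  simp_rw [← sq] at h1
  have h2 := integral_sq_pos_of_not_ae_zero hφ.memLp hne
  have h3 := gagliardoSq_nonneg s φ
  exact nonneg_of_mul_nonneg_left (h1 ▸ by positivity) h2

/-- The variational characterization of the first eigenvalue, in the direction of a Poincaré
inequality: the minimum of the Rayleigh quotient is an eigenvalue, by the Euler–Lagrange equation,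
so it is at least `λ₁`. -/
theorem firstEigenvalue_mul_integral_sq_le (hs : 0 < s) (hκ : 0 < κ)
    (hΩ : Bornology.IsBounded Ω) (hφ : MemFracEnergy s Ω φ) :
    firstEigenvalue κ s Ω * ∫ y, φ y ^ 2 ≤ fracForm κ s φ φ := by
  rw [fracForm_self]
  -- For `φ = 0` nothing is claimed about `λ₁`, so a trivial energy space does no harm.
  by_cases h0 : φ =ᵐ[volume] 0
  · rw [integral_sq_eq_zero_of_ae_zero h0, mul_zero]
    have := gagliardoSq_nonneg s φ
    positivity
  have hscale : ∀ ψ : EuclideanSpace ℝ (Fin N) → ℝ, MemFracEnergy s Ω ψ → 0 < ∫ y, ψ y ^ 2 →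
      ∃ χ : EuclideanSpace ℝ (Fin N) → ℝ, MemFracEnergy s Ω χ ∧ ∫ y, χ y ^ 2 = 1 ∧
        gagliardoSq s χ * (∫ y, ψ y ^ 2) = gagliardoSq s ψ := by
    intro ψ hψ hpos
    set c := ∫ y, ψ y ^ 2
    have hsq : (√c)⁻¹ ^ 2 = c⁻¹ := by rw [inv_pow, Real.sq_sqrt hpos.le]
    refine ⟨fun y => (√c)⁻¹ * ψ y, ?_, ?_, ?_⟩
    · have := hψ.add_mul hψ ((√c)⁻¹ - 1)
      convert this using 2
      ring
    · simp_rw [mul_pow, integral_const_mul, hsq]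
      exact inv_mul_cancel₀ hpos.ne'
    · rw [gagliardoSq_mul, hsq]
      field_simp
  have hpos := integral_sq_pos_of_not_ae_zero hφ.memLp h0
  obtain ⟨φ', hφ', hφ'1, hφ'e⟩ := hscale φ hφ hpos
  obtain ⟨m, ⟨χ, hχ, hχ1, hχm⟩, hmin⟩ := exists_isLeast_gagliardoSq hs hΩ ⟨φ', hφ', hφ'1⟩
  have hray : ∀ ψ : EuclideanSpace ℝ (Fin N) → ℝ, MemFracEnergy s Ω ψ →
      m * ∫ y, ψ y ^ 2 ≤ gagliardoSq s ψ := by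
    intro ψ hψ
    rcases (integral_nonneg fun y => sq_nonneg (ψ y) : 0 ≤ ∫ y, ψ y ^ 2).eq_or_lt with h | h
    · rw [← h, mul_zero]
      exact gagliardoSq_nonneg s ψ
    · obtain ⟨ψ', h1, h2, h3⟩ := hscale ψ hψ h
      rw [← h3]
      exact mul_le_mul_of_nonneg_right (hmin ⟨ψ', h1, h2, rfl⟩) h.le
  have heig : IsFracDirichletEigenvalue κ s Ω (κ / 2 * m) := by
    refine ⟨χ, hχ, fun h => ?_, fun ψ hψ => ?_⟩
    · rw [integral_sq_eq_zero_of_ae_zero h] at hχ1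
      exact zero_ne_one hχ1
    · rw [fracForm_eq_integral_diffQuot, mul_assoc]
      congr 1
      -- The quadratic polynomial `E(χ + t ψ) - m ‖χ + t ψ‖²` is nonnegative and vanishes at `0`.
      have h : ∀ t : ℝ, 0 ≤ (gagliardoSq s ψ - m * ∫ y, ψ y ^ 2) * (t * t) +
          (2 * ((∫ p, diffQuot s χ p * diffQuot s ψ p) - m * ∫ y, χ y * ψ y)) * t + 0 := by
        intro t
        have h1 := hray _ (hχ.add_mul hψ t)
        rw [gagliardoSq_add_mul hχ hψ t, integral_add_mul_sq hχ.memLp hψ.memLp t, hχ1, hχm] at h1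
        linarith
      have h2 := discrim_le_zero h
      rw [discrim, mul_zero, sub_zero] at h2
      have h3 := pow_eq_zero_iff (two_ne_zero) |>.1 (le_antisymm h2 (sq_nonneg _))
      linarith
  have hle : firstEigenvalue κ s Ω ≤ κ / 2 * m :=
    csInf_le ⟨0, fun μ hμ => eigenvalue_nonneg hκ hμ⟩ heig
  calc firstEigenvalue κ s Ω * ∫ y, φ y ^ 2 ≤ κ / 2 * m * ∫ y, φ y ^ 2 :=
        mul_le_mul_of_nonneg_right hle hpos.le
    _ = κ / 2 * (m * ∫ y, φ y ^ 2) := mul_assoc _ _ _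
    _ ≤ _ := mul_le_mul_of_nonneg_left (hray φ hφ) (by positivity)

end Spectrum

/-! ### The energy identity on the cylinder -/

section Cylinder

variable {N : ℕ} {α s κ a b : ℝ} {Ω : Set (EuclideanSpace ℝ (Fin N))}
  {u : ℝ → EuclideanSpace ℝ (Fin N) → ℝ}

theorem MemCylEnergy.ae_memLp_caputo (hu : MemCylEnergy α s a b Ω u) :
    ∀ᵐ y, MemLp (rightCaputoDeriv α b (fun t => u t y)) 2 (volume.restrict (Ioo a b)) := by
  filter_upwards [hu.memLp_caputo.1.prod_swap.prodMk_left,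
    hu.memLp_caputo.integrable_sq.prod_left_ae] with y h1 h2
  exact (memLp_two_iff_integrable_sq h1).2 h2

theorem MemCylEnergy.ae_memFracEnergy (hu : MemCylEnergy α s a b Ω u) :
    ∀ᵐ x ∂volume.restrict (Ioo a b), MemFracEnergy s Ω (u x) := by
  filter_upwards [hu.memLp.1.prodMk_left, hu.memLp.integrable_sq.prod_right_ae,
    hu.energy.prod_right_ae, ae_restrict_mem measurableSet_Ioo] with x h1 h2 h3 hx
  exact ⟨(memLp_two_iff_integrable_sq h1).2 h2, hu.eq_zero x (Ioo_subset_Icc_self hx), h3⟩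

theorem MemCylEnergy.integrable_fracForm (κ : ℝ) (hu : MemCylEnergy α s a b Ω u) :
    IntegrableOn (fun x => fracForm κ s (u x) (u x)) (Ioo a b) := by
  have h := (hu.energy.integral_prod_left).const_mul (κ / 2)
  simp_rw [sq] at h
  exact h

/-- The bound for functions of one variable, for almost every slice `y`. -/
theorem MemCylEnergy.ae_rlKernel_mul_sq_le (hα : 1 / 2 < α) (hα1 : α ≤ 1) (hab : a < b)
    (hu : MemCylEnergy α s a b Ω u) :
    ∀ᵐ y, ∀ x ∈ Icc a b, rlKernel α b a a * u x y ^ 2 ≤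
      (rlKernel α b a a * rlKernel α b x x - rlKernel α b a x ^ 2) *
        ∫ t in Ioo a b, rightCaputoDeriv α b (fun t => u t y) t ^ 2 := by
  filter_upwards [hu.absCont, hu.ae_memLp_caputo] with y h1 h2 x hx
  exact rlKernel_mul_sq_le hα hα1 hab hx h1.1 h1.2.1 h1.2.2 h2

theorem restrict_prod_le (μ : Measure ℝ) [SFinite μ] :
    μ.prod (volume.restrict Ω) ≤ μ.prod volume :=
  Measure.prod_mono le_rfl Measure.restrict_le_self

end Cylinder

theorem mainTheorem4 {N : ℕ} (hN : 2 < N) (Ω : Set (EuclideanSpace ℝ (Fin N)))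
    (hΩo : IsOpen Ω) (hΩb : Bornology.IsBounded Ω)
    (a b α s κ : ℝ) (hab : a < b) (hα : 1 / 2 < α) (hα1 : α ≤ 1) (hs0 : 0 < s) (hs1 : s < 1)
    (hκ : 0 < κ) (q : ℝ → ℝ) (hq : ContinuousOn q (Icc a b))
    (u : ℝ → EuclideanSpace ℝ (Fin N) → ℝ) (hu : IsContinuousSolution α s κ a b Ω q u)
    (hne : ∃ x ∈ Icc a b, ∃ y ∈ Ω, u x y ≠ 0) :
    (b - a) ^ (2 * α - 1) / (Real.Gamma α ^ 2 * (2 * α - 1)) ≤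
      ∫ t in a..b, (rlKernel α b a a * rlKernel α b t t - rlKernel α b a t ^ 2) *
        max (q t - firstEigenvalue κ s Ω) 0 := by
  have hm := hu.memEnergy
  rw [← rlKernel_self hα hab.le, intervalIntegral.integral_of_le hab.le,
    integral_Ioc_eq_integral_Ioo]
  set Λ := firstEigenvalue κ s Ω
  set A := rlKernel α b a a with hA
  set F : ℝ → ℝ := fun t => A * rlKernel α b t t - rlKernel α b a t ^ 2 with hF
  set p : ℝ → ℝ := fun t => max (q t - Λ) 0 with hp
  set w : ℝ → EuclideanSpace ℝ (Fin N) → ℝ :=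
    fun x y => rightCaputoDeriv α b (fun t => u t y) x with hw
  set U : ℝ → ℝ := fun x => ∫ y, u x y ^ 2 with hU
  set W : EuclideanSpace ℝ (Fin N) → ℝ := fun y => ∫ t in Ioo a b, w t y ^ 2 with hW
  set T : ℝ := ∫ y in Ω, W y with hT
  have hApos : 0 < A := rlKernel_self_pos hα hab
  have hpt : ∀ᵐ y, ∀ x ∈ Icc a b, A * u x y ^ 2 ≤ F x * W y :=
    hm.ae_rlKernel_mul_sq_le hα hα1 hab
  have hWnn : ∀ y, 0 ≤ W y := fun y => integral_nonneg fun _ => sq_nonneg _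
  have hw2 : Integrable (fun z : ℝ × EuclideanSpace ℝ (Fin N) => w z.1 z.2 ^ 2)
      ((volume.restrict (Ioo a b)).prod (volume.restrict Ω)) :=
    hm.memLp_caputo.integrable_sq.mono_measure (restrict_prod_le _)
  have hWint : IntegrableOn W Ω := hw2.integral_prod_right
  -- A solution is nontrivial only if its fractional derivative is.
  have hTpos : 0 < T := by
    refine (integral_nonneg hWnn).lt_of_ne fun h0 => ?_
    have hW0 : W =ᵐ[volume.restrict Ω] 0 := (integral_eq_zero_iff_of_nonneg hWnn hWint).1 h0.symm
    obtain ⟨x, hx, y, hy, hxy⟩ := hne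
    have hcont : Continuous (u x) := by
      rw [← continuousOn_univ]
      exact hu.continuousOn.comp (f := fun y => (x, y)) (by fun_prop) fun y _ => ⟨hx, mem_univ _⟩
    have hopen : IsOpen (Ω ∩ {y | u x y ≠ 0}) :=
      hΩo.inter (isOpen_ne_fun hcont continuous_const)
    refine (hopen.measure_pos volume ⟨y, hy, hxy⟩).ne' ?_
    rw [Filter.EventuallyEq, ae_restrict_iff' hΩo.measurableSet] at hW0
    refine measure_mono_null (fun z hz => ?_) (ae_iff.1 (hpt.and hW0))
    rintro ⟨h1, h2⟩
    have h3 := h1 x hx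
    rw [h2 hz.1, Pi.zero_apply, mul_zero] at h3
    have : 0 < A * u x z ^ 2 := mul_pos hApos (sq_pos_of_ne_zero hz.2)
    linarith
  have hUΩ : ∀ x ∈ Icc a b, U x = ∫ y in Ω, u x y ^ 2 := fun x hx =>
    (setIntegral_eq_integral_of_forall_compl_eq_zero fun y hy => by
      rw [hm.eq_zero x hx y hy, sq, zero_mul]).symm
  have hUint : IntegrableOn U (Ioo a b) := hm.memLp.integrable_sq.integral_prod_left
  have hUnn : ∀ x, 0 ≤ U x := fun x => integral_nonneg fun _ => sq_nonneg _
  have hEae := hm.ae_memFracEnergy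
  have hUle : ∀ᵐ x ∂volume.restrict (Ioo a b), A * U x ≤ F x * T := by
    filter_upwards [hEae, ae_restrict_mem measurableSet_Ioo] with x hx hxI
    have hxI' := Ioo_subset_Icc_self hxI
    rw [hUΩ x hxI', ← integral_const_mul, hT, ← integral_const_mul]
    exact integral_mono_ae (hx.memLp.integrable_sq.integrableOn.const_mul A)
      (hWint.const_mul (F x)) (ae_restrict_of_ae (hpt.mono fun y hy => hy x hxI'))
  have hULe : ∀ᵐ x ∂volume.restrict (Ioo a b), Λ * U x ≤ fracForm κ s (u x) (u x) :=
    hEae.mono fun x hx => firstEigenvalue_mul_integral_sq_le hs0 hκ hΩb hx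
  have hmulU : ∀ g : ℝ → ℝ, ContinuousOn g (Icc a b) →
      IntegrableOn (fun x => g x * U x) (Ioo a b) := fun g hg =>
    (IntegrableOn.continuousOn_mul hg
      ((integrableOn_Icc_iff_integrableOn_Ioo (by simp) (by simp)).2 hUint)
      isCompact_Icc).mono_set Ioo_subset_Icc_self
  have hpc : ContinuousOn p (Icc a b) := (hq.sub continuousOn_const).sup continuousOn_const
  have hpF : IntegrableOn (fun x => F x * p x) (Ioo a b) :=
    integrableOn_gramDet_mul hα hab (hpc.integrableOn_Icc.mono_set Ioo_subset_Icc_self)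
  -- The energy identity: the weak equation tested with the solution itself.
  have hweak : T + ∫ x in Ioo a b, fracForm κ s (u x) (u x) = ∫ x in Ioo a b, q x * U x := by
    have h := hu.weak u hm
    have h1 : ∫ x in Ioo a b, ∫ y in Ω, rightCaputoDeriv α b (fun t => u t y) x *
        rightCaputoDeriv α b (fun t => u t y) x = T := by
      simp_rw [← sq]
      exact integral_integral_swap hw2
    have h2 : ∫ x in Ioo a b, ∫ y in Ω, q x * u x y * u x y = ∫ x in Ioo a b, q x * U x := by
      refine setIntegral_congr_fun measurableSet_Ioo fun x hx => ?_
      simp only [mul_assoc]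
      rw [integral_const_mul, hUΩ x (Ioo_subset_Icc_self hx)]
      simp_rw [sq]
    rwa [h1, h2] at h
  have hT1 : T ≤ ∫ x in Ioo a b, p x * U x := by
    have h1 : T = ∫ x in Ioo a b, (q x * U x - fracForm κ s (u x) (u x)) := by
      rw [integral_sub (hmulU q hq) (hm.integrable_fracForm κ)]
      linarith
    rw [h1]
    refine integral_mono_ae ((hmulU q hq).sub (hm.integrable_fracForm κ)) (hmulU p hpc) ?_
    filter_upwards [hULe] with x hx
    have := mul_le_mul_of_nonneg_right (le_max_left (q x - Λ) 0) (hUnn x)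
    simp only [hp]
    linarith
  have hT2 : ∫ x in Ioo a b, A * (p x * U x) ≤ ∫ x in Ioo a b, F x * p x * T := by
    refine integral_mono_ae ((hmulU p hpc).const_mul A) (hpF.mul_const T) ?_
    filter_upwards [hUle] with x hx
    have := mul_le_mul_of_nonneg_left hx (le_max_right (q x - Λ) 0 : 0 ≤ p x)
    linarith
  rw [integral_const_mul, integral_mul_const] at hT2
  exact le_of_mul_le_mul_right ((mul_le_mul_of_nonneg_left hT1 hApos.le).trans hT2) hTpos
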